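/- **Setting.** Let $f:\{0,1\}^n\to\{0,1\}$ be symmetric, i.e. $f(x)$ depends only on the number of ones of $x$, and let $R=(R[0],\dots,R[n])$ be its value vector, where $R[j]$ is the value of $f$ on inputs with exactly $j$ ones. A test of $x_i$ reveals $x_i$ and costs $c_i>0$; the bits are independent with $\Pr[x_i=1]=p_i$, $0<p_i<1$. An adaptive evaluation strategy for $f$ is a Boolean decision tree that computes $f$; its expected cost is $\sum_{x}p(x)C(x)$, where $p(x)=\prod_i p_i^{x_i}(1-p_i)^{1-x_i}$ and $C(x)$ is the sum of the costs of the tests performed on $x$. The Stochastic Boolean Function Evaluation (SBFE) problem asks for a strategy of minimum expected cost. For a partial assignment $b\in\{0,1,*\}^n$ let $N_\ell(b)$ be the number of its entries equal to $\ell$. A block of $R$ is a maximal run of equal consecutive entries. Let $G$ be the graph on the positions $0,\dots,n$ in which two positions are adjacent iff they lie in different blocks of $R$. Let $g(b)$ be the number of edges of $G$ having at least one endpoint $i$ with $i<N_1(b)$ or $i>n-N_0(b)$, and let $Q$ be the number of all edges of $G$. Adaptive Greedy for $g$ stops as soon as the partial assignment $b$ of outcomes satisfies $g(b)=Q$; until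 then it tests an untested variable $x_i$ maximizing $\frac1{c_i}\big(p_i\,g(b_{i\leftarrow1})+(1-p_i)\,g(b_{i\leftarrow0})-g(b)\big)$, ties being broken arbitrarily. **Theorem 2.** There is a polynomial-time $O(\log n)$-approximation algorithm for the SBFE problem for symmetric Boolean functions, with arbitrary costs and independent bits with arbitrary probabilities. More precisely, there is a constant $K$ such that the following hold. 1. For every $n$ and every symmetric $f$, the function $g$ is a goal function for $f$ with goal value $Q\le n(n+1)/2$: it is monotone, submodular, $g(*,\dots,*)=0$, and $g(b)=Q$ iff $f$ is constant on all assignments extending $b$. 2. For every $n\ge2$, every symmetric $f$, and all real $c_i>0$ and $0<p_i<1$, the expected cost of every run of Adaptive Greedy for $g$ (as a decision tree) is at most $K\log n$ times the expected cost of every adaptive evaluation strategy for $f$. 3. There are a single program (of a random access machine with logarithmic cost) and a polynomial $q$ such that for every $n$, every symmetric $f$, and all rational $c_i>0$ and $0<p_i<1$ the following holds. On input $n$, $R$, $(c_i)$, $(p_i)$ in binary, the program carries out Adaptive Greedy for $g$ on-line, performing one test after another. On every $x$ it halts in time at most $q(\text{bit length of the input})$ and outputs $f(x)$. If $n\ge2$,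 its expected testing cost is at most $K\log n$ times that of every adaptive evaluation strategy for $f$. -/

import Mathlib

namespace SBFE

/-! ### Boolean functions and partial assignments -/

/-- `N₁(x)`: the number of ones of a full assignment. -/
def numOnes {n : ℕ} (x : Fin n → Bool) : ℕ :=
  (Finset.univ.filter fun i => x i = true).card

/-- A Boolean function is symmetric if its output depends only on the number of ones. -/
def IsSymmetric {n : ℕ} (f : (Fin n → Bool) → Bool) : Prop :=
  ∀ x y, numOnes x = numOnes y → f x = f y

/-- The value vector of a symmetric function: entry `j` is the value of `f` on inputs with
exactly `j` ones (read off at the input whose first `j` bits are one). -/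
def valueVector {n : ℕ} (f : (Fin n → Bool) → Bool) : Fin (n + 1) → Bool :=
  fun j => f fun i => decide ((i : ℕ) < (j : ℕ))

/-- An element of `{0,1,*}ⁿ`; `none` stands for `*`. -/
abbrev PartialAssignment (n : ℕ) : Type := Fin n → Option Bool

/-- `N_ℓ(b)`: the number of entries of `b` that are set to `ℓ`. -/
def count {n : ℕ} (l : Bool) (b : PartialAssignment n) : ℕ :=
  (Finset.univ.filter fun i => b i = some l).card

/-- `b' ⪰ b`. -/
def Extends {n : ℕ} (b' b : PartialAssignment n) : Prop :=
  ∀ i, b i ≠ none → b' i = b i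

/-- The partial assignment `b_{i ← ℓ}`. -/
def setBit {n : ℕ} (b : PartialAssignment n) (i : Fin n) (l : Bool) : PartialAssignment n :=
  Function.update b i (some l)

/-- `b` is a certificate for `f`: all full assignments extending `b` have the same value. -/
def IsCertificate {n : ℕ} (f : (Fin n → Bool) → Bool) (b : PartialAssignment n) : Prop :=
  ∀ a a' : Fin n → Bool, Extends (fun i => some (a i)) b → Extends (fun i => some (a' i)) b →
    f a = f a'

/-! ### Goal functions -/

def IsMonotone {n : ℕ} (g : PartialAssignment n → ℕ) : Prop :=
  ∀ b b' : PartialAssignment n, Extends b' b → g b ≤ g b'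

def IsSubmodular {n : ℕ} (g : PartialAssignment n → ℕ) : Prop :=
  ∀ (b b' : PartialAssignment n) (i : Fin n) (l : Bool), Extends b' b → b i = none → b' i = none →
    (g (setBit b' i l) : ℤ) - g b' ≤ (g (setBit b i l) : ℤ) - g b

/-- `g` is a (submodular) goal function for `f` with goal value `Q`. -/
structure IsGoalFunction {n : ℕ} (f : (Fin n → Bool) → Bool) (g : PartialAssignment n → ℕ)
    (Q : ℕ) : Prop where
  submodular : IsSubmodular g
  monotone : IsMonotone g
  map_empty : g (fun _ => none) = 0
  eq_goal_iff : ∀ b, g b = Q ↔ IsCertificate f b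

/-- Positions `s` and `t` of a value vector lie in the same block (maximal constant run). -/
def SameBlock {n : ℕ} (R : Fin (n + 1) → Bool) (s t : Fin (n + 1)) : Prop :=
  ∀ k, min s t ≤ k → k ≤ max s t → R k = R s

instance {n : ℕ} (R : Fin (n + 1) → Bool) (s t : Fin (n + 1)) : Decidable (SameBlock R s t) := by
  unfold SameBlock; infer_instance

/-- The edges, written as pairs `s < t`, of the complete multipartite graph on the positions of
the value vector whose parts are the blocks. -/
def blockEdges {n : ℕ} (R : Fin (n + 1) → Bool) : Finset (Fin (n + 1) × Fin (n + 1)) :=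
  Finset.univ.filter fun e => e.1 < e.2 ∧ ¬ SameBlock R e.1 e.2

/-- Vertex `v` is one of the first `N₁(b)` or one of the last `N₀(b)` positions. -/
def Removed {n : ℕ} (b : PartialAssignment n) (v : Fin (n + 1)) : Prop :=
  (v : ℕ) < count true b ∨ n < (v : ℕ) + count false b

instance {n : ℕ} (b : PartialAssignment n) (v : Fin (n + 1)) : Decidable (Removed b v) := by
  unfold Removed; infer_instance

/-- The utility `g(b)`: the number of edges with at least one endpoint removed by `b`. -/
def goalFunction {n : ℕ} (R : Fin (n + 1) → Bool) (b : PartialAssignment n) : ℕ :=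
  ((blockEdges R).filter fun e => Removed b e.1 ∨ Removed b e.2).card

/-- The goal value `Q` of `goalFunction R`: the number of all edges. -/
def goalValue {n : ℕ} (R : Fin (n + 1) → Bool) : ℕ := (blockEdges R).card

/-! ### Adaptive evaluation strategies -/

/-- Boolean decision trees; `node i lo hi` tests `x i` and continues with `lo` if the outcome
is `0` and with `hi` if it is `1`. -/
inductive DecisionTree (n : ℕ) : Type
  | leaf (v : Bool) : DecisionTree n
  | node (i : Fin n) (lo hi : DecisionTree n) : DecisionTree n

namespace DecisionTree

/-- The label of the leaf that `x` reaches. -/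
def eval {n : ℕ} : DecisionTree n → (Fin n → Bool) → Bool
  | leaf v, _ => v
  | node i lo hi, x => if x i then hi.eval x else lo.eval x

/-- The tests performed on `x`, in order. -/
def tests {n : ℕ} : DecisionTree n → (Fin n → Bool) → List (Fin n)
  | leaf _, _ => []
  | node i lo hi, x => i :: (if x i then hi.tests x else lo.tests x)

/-- The tree computes `f`, i.e. it is an adaptive evaluation strategy for `f`. -/
def Computes {n : ℕ} (T : DecisionTree n) (f : (Fin n → Bool) → Bool) : Prop :=
  ∀ x, T.eval x = f x

/-- The expected cost `∑ₓ C(T, x) p(x)` for costs `c` and independent bits, bit `i` being one with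
probability `p i`. -/
noncomputable def expectedCost {n : ℕ} (c p : Fin n → ℝ) (T : DecisionTree n) : ℝ :=
  ∑ x : Fin n → Bool, ((T.tests x).map c).sum * ∏ i, (if x i then p i else 1 - p i)

end DecisionTree

/-- The expected increase of the utility `g` when `i` is tested in the state `b`. -/
noncomputable def expectedGain {n : ℕ} (g : PartialAssignment n → ℕ) (p : Fin n → ℝ)
    (b : PartialAssignment n) (i : Fin n) : ℝ :=
  p i * ((g (setBit b i true) : ℝ) - g b) + (1 - p i) * ((g (setBit b i false) : ℝ) - g b)

/-- The strategy, started in the state `b`, is a run of Adaptive Greedy for the utility `g` and the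
goal value `Q`: it stops exactly when the utility reaches `Q`, and until then it tests
an untested variable that maximizes the expected increase of the utility per unit cost (ties may be
broken arbitrarily). -/
def IsAdaptiveGreedyFrom {n : ℕ} (g : PartialAssignment n → ℕ) (Q : ℕ) (c p : Fin n → ℝ) :
    PartialAssignment n → DecisionTree n → Prop
  | b, .leaf _ => g b = Q
  | b, .node i lo hi =>
      g b ≠ Q ∧ b i = none ∧
      (∀ j, b j = none → expectedGain g p b j / c j ≤ expectedGain g p b i / c i) ∧
      IsAdaptiveGreedyFrom g Q c p (setBit b i false) lo ∧
      IsAdaptiveGreedyFrom g Q c p (setBit b i true) hi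

/-- Adaptive Greedy for `g` and `Q`, started with no variable tested. -/
def IsAdaptiveGreedy {n : ℕ} (g : PartialAssignment n → ℕ) (Q : ℕ) (c p : Fin n → ℝ)
    (T : DecisionTree n) : Prop :=
  IsAdaptiveGreedyFrom g Q c p (fun _ => none) T

/-! ### The machine model: random access machines with logarithmic cost

A machine has a read-only input (a list of natural numbers), an unbounded random access memory of
natural numbers, initially all zero, and an instruction that performs a test. The time of each
operation is one plus the bit lengths of the numbers involved, so polynomial time here is the usual
polynomial time of Turing machines. -/

abbrev Memory : Type := ℕ → ℕ

inductive Expr : Type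
  /-- a constant -/
  | lit (k : ℕ) : Expr
  /-- the entry of the input at the given position (`0` beyond its end) -/
  | input (e : Expr) : Expr
  /-- the content of the memory cell with the given address -/
  | cell (e : Expr) : Expr
  | add (e₁ e₂ : Expr) : Expr
  /-- truncated subtraction -/
  | sub (e₁ e₂ : Expr) : Expr
  | mul (e₁ e₂ : Expr) : Expr

namespace Expr

def eval (w : List ℕ) (m : Memory) : Expr → ℕ
  | lit k => k
  | input e => w.getD (e.eval w m) 0
  | cell e => m (e.eval w m)
  | add e₁ e₂ => e₁.eval w m + e₂.eval w m
  | sub e₁ e₂ => e₁.eval w m - e₂.eval w m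
  | mul e₁ e₂ => e₁.eval w m * e₂.eval w m

/-- The time for evaluating an expression. Each operation costs one plus the bit length of its
result; the bit lengths of its operands are part of the time spent on them. -/
def time (w : List ℕ) (m : Memory) : Expr → ℕ
  | lit k => Nat.size k + 1
  | input e => e.time w m + Nat.size ((input e).eval w m) + 1
  | cell e => e.time w m + Nat.size ((cell e).eval w m) + 1
  | add e₁ e₂ => e₁.time w m + e₂.time w m + Nat.size ((add e₁ e₂).eval w m) + 1
  | sub e₁ e₂ => e₁.time w m + e₂.time w m + Nat.size ((sub e₁ e₂).eval w m) + 1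
  | mul e₁ e₂ => e₁.time w m + e₂.time w m + Nat.size ((mul e₁ e₂).eval w m) + 1

end Expr

inductive Program : Type
  | skip : Program
  /-- store the value of `e` in the cell with address `a` -/
  | assign (a e : Expr) : Program
  /-- test the variable with index `e` and store the outcome in the cell with address `a` -/
  | test (a e : Expr) : Program
  | seq (P₁ P₂ : Program) : Program
  /-- run `P₁` if `e` is nonzero and `P₂` if it is zero -/
  | cond (e : Expr) (P₁ P₂ : Program) : Program
  /-- repeat `P` as long as `e` is nonzero -/
  | loop (e : Expr) (P : Program) : Program

/-- `Exec w x P m L t m'`: on the input `w`, with the (hidden) assignment `x`, the program `P` started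
in the memory `m` halts after time `t` in the memory `m'`, having performed the tests `L`, in this
order. A test of a variable that does not exist has no execution. -/
inductive Exec {n : ℕ} (w : List ℕ) (x : Fin n → Bool) :
    Program → Memory → List (Fin n) → ℕ → Memory → Prop
  | skip (m : Memory) : Exec w x .skip m [] 1 m
  | assign (a e : Expr) (m : Memory) :
      Exec w x (.assign a e) m [] (a.time w m + e.time w m + 1)
        (Function.update m (a.eval w m) (e.eval w m))
  | test (a e : Expr) (m : Memory) (h : e.eval w m < n) :
      Exec w x (.test a e) m [⟨e.eval w m, h⟩] (a.time w m + e.time w m + 1)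
        (Function.update m (a.eval w m) (x ⟨e.eval w m, h⟩).toNat)
  | seq {P₁ P₂ : Program} {m m₁ m₂ : Memory} {L₁ L₂ : List (Fin n)} {t₁ t₂ : ℕ} :
      Exec w x P₁ m L₁ t₁ m₁ → Exec w x P₂ m₁ L₂ t₂ m₂ →
      Exec w x (.seq P₁ P₂) m (L₁ ++ L₂) (t₁ + t₂ + 1) m₂
  | cond_true {e : Expr} {P₁ P₂ : Program} {m m' : Memory} {L : List (Fin n)} {t : ℕ} :
      e.eval w m ≠ 0 → Exec w x P₁ m L t m' →
      Exec w x (.cond e P₁ P₂) m L (e.time w m + t + 1) m'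
  | cond_false {e : Expr} {P₁ P₂ : Program} {m m' : Memory} {L : List (Fin n)} {t : ℕ} :
      e.eval w m = 0 → Exec w x P₂ m L t m' →
      Exec w x (.cond e P₁ P₂) m L (e.time w m + t + 1) m'
  | loop_done {e : Expr} {P : Program} {m : Memory} :
      e.eval w m = 0 → Exec w x (.loop e P) m [] (e.time w m + 1) m
  | loop_step {e : Expr} {P : Program} {m m₁ m₂ : Memory} {L₁ L₂ : List (Fin n)} {t₁ t₂ : ℕ} :
      e.eval w m ≠ 0 → Exec w x P m L₁ t₁ m₁ → Exec w x (.loop e P) m₁ L₂ t₂ m₂ →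
      Exec w x (.loop e P) m (L₁ ++ L₂) (e.time w m + t₁ + t₂ + 1) m₂

/-- On the input `w`, the program `P` carries out the adaptive strategy `T` on-line within time `t`:
on every assignment `x` it halts within time `t`, having performed exactly the tests of `T` on `x`
in the same order, and it leaves the output of `T` in cell `0`. -/
def Implements {n : ℕ} (P : Program) (w : List ℕ) (T : DecisionTree n) (t : ℕ) : Prop :=
  ∀ x : Fin n → Bool, ∃ (s : ℕ) (m : Memory),
    Exec w x P (fun _ => 0) (T.tests x) s m ∧ s ≤ t ∧ m 0 = (T.eval x).toNat

/-- The input of the evaluation problem: `n`, the value vector, and the numerators and the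
denominators of the costs and of the probabilities. -/
def encodeInstance {n : ℕ} (R : Fin (n + 1) → Bool) (c p : Fin n → ℚ) : List ℕ :=
  [n] ++ List.ofFn (fun j => (R j).toNat) ++
    List.ofFn (fun i => (c i).num.toNat) ++ List.ofFn (fun i => (c i).den) ++
    List.ofFn (fun i => (p i).num.toNat) ++ List.ofFn (fun i => (p i).den)

/-- The bit length of an input. -/
def inputSize (w : List ℕ) : ℕ := (w.map fun k => Nat.size k + 1).sum

end SBFE

open SBFE

namespace SBFE

/-! Write s = N₁(b) and t = n − N₀(b). The inputs that extend b realize exactly the numbers of ones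
from s to t, and the positions not removed by b form the same interval. Hence g(b) is Q minus the
number of edges inside [s, t], and this number is zero iff R is constant there, i.e. iff b is a
certificate (`isCertificate_iff`). An outcome one gains the degree of s inside the interval, an
outcome zero the degree of t. Two positions separated by a change of value stay separated when they
are moved apart, so these degrees only drop as the interval shrinks (`upGain_anti`,
`downGain_anti`); this is submodularity.

For every goal function, Adaptive Greedy is within the factor H(Q) of any strategy T', where H is
the harmonic number. By induction on the greedy tree T, from every state b the remaining cost of T
is at most H(Q − g(b)) times that of T'. Let T test i in b with gain rate ρ per unit cost, let π be
the probability that T' tests i, and A the expected cost of T' before that test. If T' is cut off at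
i, submodularity limits its gain to ρA, whereas it reaches Q with probability at least 1 − π; so (1
− π)(Q − g(b)) ≤ ρA (`goal_le_of_reaches`). The cost of T' is π·c i plus the average of its costs
given x i (`residualCost_split`). Each of the latter is at least A, because T' cannot react to x i
before testing it. When g rises by δ, H drops by at least δ/(Q − g(b)). On average this releases at
least Aρ·c i/(Q − g(b)) ≥ (1 − π)·c i, which pays for the part of c i that T' does not pay itself.
Finally H(Q) ≤ 4 log n, since Q ≤ n².

The program follows this strategy in integer arithmetic: it finds both gains by scanning R and
compares ratios by cross multiplication. Cells hold numbers of bit length linear in that of the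
input, and each loop makes at most n passes, so a polynomial time bound can be read off from the
program text. -/

variable {n : ℕ}

/-! ### Ones and zeros of partial assignments and of their extensions -/

section Counting

theorem count_setBit_self {b : PartialAssignment n} {i : Fin n} (hi : b i = none) (l : Bool) :
    count l (setBit b i l) = count l b + 1 := by
  unfold count setBit
  rw [← Finset.card_insert_of_notMem (s := Finset.univ.filter fun j => b j = some l) (a := i)
    (by simp [hi])]
  congr 1
  ext j
  by_cases h : j = i <;> simp [Function.update_apply, h]

theorem count_setBit_ne {b : PartialAssignment n} {i : Fin n} (hi : b i = none) {l l' : Bool}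
    (h : l ≠ l') : count l (setBit b i l') = count l b := by
  unfold count setBit
  congr 1
  ext j
  by_cases hj : j = i
  · subst hj; simp [hi, h.symm]
  · simp [Function.update_apply, hj]

theorem count_add_count (b : PartialAssignment n) :
    count true b + count false b + (Finset.univ.filter fun i => b i = none).card = n := by
  unfold count
  simp only [Finset.card_filter, ← Finset.sum_add_distrib]
  rw [Finset.sum_congr rfl (g := fun _ => 1)]
  · simp
  · intro i _
    rcases b i with _ | _ | _ <;> simp

theorem count_add_count_le (b : PartialAssignment n) : count true b + count false b ≤ n := by
  have := count_add_count b; omega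

theorem count_add_count_lt {b : PartialAssignment n} {i : Fin n} (hi : b i = none) :
    count true b + count false b < n := by
  have := count_add_count b
  have : 0 < (Finset.univ.filter fun i => b i = none).card :=
    Finset.card_pos.2 ⟨i, by simp [hi]⟩
  omega

theorem Extends.count_le {b b' : PartialAssignment n} (h : Extends b' b) (l : Bool) :
    count l b ≤ count l b' := by
  refine Finset.card_le_card fun i hi => ?_
  simp only [Finset.mem_filter, Finset.mem_univ, true_and] at hi ⊢
  rw [h i (by simp [hi]), hi]

theorem count_full (l : Bool) (x : Fin n → Bool) :
    count l (fun i => some (x i)) = (Finset.univ.filter fun i => x i = l).card := by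
  simp [count]

theorem numOnes_le (x : Fin n → Bool) : numOnes x ≤ n :=
  (Finset.card_filter_le _ _).trans_eq (Finset.card_fin n)

theorem Extends.numOnes_mem {b : PartialAssignment n} {x : Fin n → Bool}
    (h : Extends (fun i => some (x i)) b) :
    count true b ≤ numOnes x ∧ numOnes x ≤ n - count false b := by
  have h1 := h.count_le true
  have h0 := h.count_le false
  have := count_add_count_le (fun i => some (x i))
  rw [count_full true] at h1 this
  unfold numOnes
  omega

theorem exists_extends_numOnes (b : PartialAssignment n) {j : ℕ} (h1 : count true b ≤ j)
    (h2 : j ≤ n - count false b) :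
    ∃ x : Fin n → Bool, Extends (fun i => some (x i)) b ∧ numOnes x = j := by
  have hsub : (Finset.univ.filter fun i => b i = some true) ⊆
      Finset.univ.filter fun i => b i ≠ some false := by
    intro i; simp +contextual
  have hc : (Finset.univ.filter fun i => b i ≠ some false).card = n - count false b := by
    have := Finset.card_filter_add_card_filter_not (s := (Finset.univ : Finset (Fin n)))
      (fun i => b i = some false)
    simp only [Finset.card_univ, Fintype.card_fin] at this
    unfold count
    simp only [ne_eq]
    omega
  -- The ones of the wanted input: any set of size `j` between the positions forced to be one and
  -- those not forced to be zero.
  obtain ⟨u, hu1, hu2, hu⟩ := Finset.exists_subsuperset_card_eq hsub h1 (by omega)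
  refine ⟨fun i => decide (i ∈ u), fun i hi => ?_, ?_⟩
  · cases hb : b i with
    | none => exact absurd hb hi
    | some l =>
      cases l with
      | false =>
        have : i ∉ u := fun h => by simpa [hb] using hu2 h
        simp [this]
      | true =>
        have : i ∈ u := hu1 (by simp [hb])
        simp [this]
  · simp [numOnes, hu]

end Counting

theorem numOnes_initial {j : ℕ} (hj : j ≤ n) :
    numOnes (fun i : Fin n => decide ((i : ℕ) < j)) = j := by
  simp only [numOnes, decide_eq_true_eq]
  rw [Fin.card_filter_val_lt]
  omega

theorem IsSymmetric.eq_valueVector {f : (Fin n → Bool) → Bool} (hf : IsSymmetric f)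
    (x : Fin n → Bool) (j : Fin (n + 1)) (h : numOnes x = j) : f x = valueVector f j :=
  hf _ _ (by rw [numOnes_initial (by omega), h])

/-! ### The block graph and its goal function -/

section Blocks

variable (R : Fin (n + 1) → Bool)

/-- The number of edges between two positions of the interval from `s` to `t`. -/
def remainingEdges (s t : ℕ) : ℕ :=
  ((blockEdges R).filter fun e => s ≤ (e.1 : ℕ) ∧ (e.2 : ℕ) ≤ t).card

/-- The number of edges from `s` to later positions up to `t`. -/
def upGain (s t : ℕ) : ℕ :=
  ((blockEdges R).filter fun e => (e.1 : ℕ) = s ∧ (e.2 : ℕ) ≤ t).card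

/-- The number of edges from `t` to earlier positions down to `s`. -/
def downGain (s t : ℕ) : ℕ :=
  ((blockEdges R).filter fun e => s ≤ (e.1 : ℕ) ∧ (e.2 : ℕ) = t).card

variable {R}

theorem mem_blockEdges {e : Fin (n + 1) × Fin (n + 1)} :
    e ∈ blockEdges R ↔ e.1 < e.2 ∧ ∃ k, e.1 ≤ k ∧ k ≤ e.2 ∧ R k ≠ R e.1 := by
  simp only [blockEdges, Finset.mem_filter, Finset.mem_univ, true_and, SameBlock, not_forall]
  constructor
  · rintro ⟨h, k, h1, h2, h3⟩
    rw [min_eq_left h.le] at h1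
    rw [max_eq_right h.le] at h2
    exact ⟨h, k, h1, h2, h3⟩
  · rintro ⟨h, k, h1, h2, h3⟩
    exact ⟨h, k, by rwa [min_eq_left h.le], by rwa [max_eq_right h.le], h3⟩

theorem remainingEdges_succ_left (s t : ℕ) :
    remainingEdges R s t = remainingEdges R (s + 1) t + upGain R s t := by
  unfold remainingEdges upGain
  rw [← Finset.card_union_of_disjoint]
  · congr 1
    ext e
    simp only [Finset.mem_filter, Finset.mem_union]
    grind
  · rw [Finset.disjoint_left]
    intro e
    simp only [Finset.mem_filter]
    grind

theorem remainingEdges_succ_right (s t : ℕ) :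
    remainingEdges R s (t + 1) = remainingEdges R s t + downGain R s (t + 1) := by
  unfold remainingEdges downGain
  rw [← Finset.card_union_of_disjoint]
  · congr 1
    ext e
    simp only [Finset.mem_filter, Finset.mem_union]
    grind
  · rw [Finset.disjoint_left]
    intro e
    simp only [Finset.mem_filter]
    grind

theorem remainingEdges_anti {s s' t t' : ℕ} (hs : s ≤ s') (ht : t' ≤ t) :
    remainingEdges R s' t' ≤ remainingEdges R s t := by
  refine Finset.card_le_card fun e => ?_
  simp only [Finset.mem_filter]
  grind

/-- An edge from `s'` to `v` can be replaced by the pair of `s` and `v`: the longer stretch still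
contains the change of value. For `s > n` there are no edges to count. -/
theorem upGain_anti {s s' t t' : ℕ} (hs : s ≤ s') (ht : t' ≤ t) :
    upGain R s' t' ≤ upGain R s t := by
  rcases Nat.lt_or_ge n s with h | h
  · refine le_trans (le_of_eq ?_) (Nat.zero_le _)
    rw [upGain, Finset.card_eq_zero, Finset.filter_eq_empty_iff]
    intro e _
    have := e.1.2
    omega
  · refine Finset.card_le_card_of_injOn (fun e => (⟨s, by omega⟩, e.2)) ?_ ?_
    · intro e he
      simp only [Finset.coe_filter, Set.mem_ofPred_eq, mem_blockEdges, Fin.le_def, Fin.lt_def] at he ⊢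
      obtain ⟨⟨h1, k, h2, h3, h4⟩, h5, h6⟩ := he
      refine ⟨⟨by omega, ?_⟩, trivial, by omega⟩
      -- The position that differs from `s` is the old witness `k` if the old and the new lower end
      -- agree, and the old lower end otherwise.
      by_cases hR : R e.1 = R ⟨s, by omega⟩
      · exact ⟨k, by omega, h3, by rwa [← hR]⟩
      · exact ⟨e.1, by omega, by omega, hR⟩
    · intro e he e' he' h
      simp only [Finset.coe_filter, Set.mem_ofPred_eq] at he he'
      simp only [Prod.mk.injEq, true_and] at h
      exact Prod.ext (Fin.ext (by omega)) h

theorem downGain_anti {s s' t t' : ℕ} (hs : s ≤ s') (ht : t' ≤ t) (hn : t ≤ n) :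
    downGain R s' t' ≤ downGain R s t := by
  refine Finset.card_le_card_of_injOn (fun e => (e.1, ⟨t, by omega⟩)) ?_ ?_
  · intro e he
    simp only [Finset.coe_filter, Set.mem_ofPred_eq, mem_blockEdges, Fin.le_def, Fin.lt_def] at he ⊢
    obtain ⟨⟨h1, k, h2, h3, h4⟩, h5, h6⟩ := he
    exact ⟨⟨by omega, k, h2, by omega, h4⟩, by omega, trivial⟩
  · intro e he e' he' h
    simp only [Finset.coe_filter, Set.mem_ofPred_eq] at he he'
    simp only [Prod.mk.injEq, and_true] at h
    exact Prod.ext h (Fin.ext (by omega))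

/-- The positions that survive form an interval, so an edge avoids all removed positions iff its
lower end is beyond the removed prefix and its upper end before the removed suffix. -/
theorem goalFunction_add_remainingEdges (b : PartialAssignment n) :
    goalFunction R b + remainingEdges R (count true b) (n - count false b) = goalValue R := by
  unfold goalFunction remainingEdges goalValue
  rw [← Finset.card_filter_add_card_filter_not (s := blockEdges R)
    (fun e => Removed b e.1 ∨ Removed b e.2)]
  congr 2
  refine Finset.filter_congr fun e he => ?_
  have h1 := (mem_blockEdges.1 he).1
  have := count_add_count_le b
  simp only [Removed, Fin.lt_def] at h1 ⊢
  omega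

theorem remainingEdges_eq_zero_iff {s t : ℕ} :
    remainingEdges R s t = 0 ↔
      ∀ u v : Fin (n + 1), s ≤ u → u ≤ v → (v : ℕ) ≤ t → R v = R u := by
  rw [remainingEdges, Finset.card_eq_zero, Finset.filter_eq_empty_iff]
  constructor
  · intro h u v hu huv hv
    by_contra hne
    have hlt : u < v := lt_of_le_of_ne huv fun h => hne (by rw [h])
    exact h (x := (u, v)) (mem_blockEdges.2 ⟨hlt, v, huv, le_rfl, hne⟩) ⟨hu, hv⟩
  · rintro h e he ⟨h1, h2⟩
    obtain ⟨_, k, h3, h4, h5⟩ := mem_blockEdges.1 he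
    exact h5 (h e.1 k h1 h3 (le_trans h4 h2))

theorem goalFunction_setBit_true {b : PartialAssignment n} {i : Fin n} (hi : b i = none) :
    goalFunction R (setBit b i true) =
      goalFunction R b + upGain R (count true b) (n - count false b) := by
  have h := goalFunction_add_remainingEdges (R := R) b
  have h' := goalFunction_add_remainingEdges (R := R) (setBit b i true)
  rw [count_setBit_self hi, count_setBit_ne hi (by decide)] at h'
  rw [remainingEdges_succ_left] at h
  omega

theorem goalFunction_setBit_false {b : PartialAssignment n} {i : Fin n} (hi : b i = none) :
    goalFunction R (setBit b i false) =
      goalFunction R b + downGain R (count true b) (n - count false b) := by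
  have h := goalFunction_add_remainingEdges (R := R) b
  have h' := goalFunction_add_remainingEdges (R := R) (setBit b i false)
  have hlt := count_add_count_lt hi
  rw [count_setBit_self hi, count_setBit_ne hi (by decide)] at h'
  -- An untested variable keeps the upper end of the interval positive, so lowering it by one is not
  -- truncated.
  obtain ⟨t, ht⟩ : ∃ t, n - count false b = t + 1 := ⟨n - count false b - 1, by omega⟩
  rw [ht] at h ⊢
  rw [show n - (count false b + 1) = t by omega] at h'
  rw [remainingEdges_succ_right] at h
  omega

theorem goalFunction_eq_goalValue_iff {b : PartialAssignment n} :
    goalFunction R b = goalValue R ↔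
      remainingEdges R (count true b) (n - count false b) = 0 := by
  have := goalFunction_add_remainingEdges (R := R) b
  omega

/-- By symmetry only numbers of ones matter, and the extensions of `b` attain every number in the
interval and no other. -/
theorem isCertificate_iff {f : (Fin n → Bool) → Bool} (hf : IsSymmetric f)
    (b : PartialAssignment n) :
    IsCertificate f b ↔
      remainingEdges (valueVector f) (count true b) (n - count false b) = 0 := by
  rw [remainingEdges_eq_zero_iff]
  constructor
  · intro h u v hu huv hv
    obtain ⟨a, ha, hau⟩ := exists_extends_numOnes b hu (le_trans huv hv)
    obtain ⟨a', ha', hav⟩ := exists_extends_numOnes b (le_trans hu huv) hv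
    rw [← hf.eq_valueVector a u hau, ← hf.eq_valueVector a' v hav]
    exact h _ _ ha' ha
  · intro h a a' ha ha'
    have h1 := ha.numOnes_mem
    have h2 := ha'.numOnes_mem
    let u : Fin (n + 1) := ⟨numOnes a, by have := numOnes_le a; omega⟩
    let v : Fin (n + 1) := ⟨numOnes a', by have := numOnes_le a'; omega⟩
    rw [hf.eq_valueVector a u rfl, hf.eq_valueVector a' v rfl]
    rcases le_total u v with huv | huv
    · exact (h u v h1.1 huv h2.2).symm
    · exact h v u h2.1 huv h1.2

theorem goalFunction_isGoalFunction {f : (Fin n → Bool) → Bool} (hf : IsSymmetric f) :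
    IsGoalFunction f (goalFunction (valueVector f)) (goalValue (valueVector f)) where
  submodular := by
    intro b b' i l h hi hi'
    have h1 := h.count_le true
    have h0 := h.count_le false
    cases l with
    | false =>
      rw [goalFunction_setBit_false hi, goalFunction_setBit_false hi']
      have := downGain_anti (R := valueVector f) h1 (Nat.sub_le_sub_left h0 n)
        (Nat.sub_le _ _)
      push_cast
      omega
    | true =>
      rw [goalFunction_setBit_true hi, goalFunction_setBit_true hi']
      have := upGain_anti (R := valueVector f) h1 (Nat.sub_le_sub_left h0 n)
      push_cast
      omega
  monotone := by
    intro b b' h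
    have := remainingEdges_anti (R := valueVector f) (h.count_le true)
      (Nat.sub_le_sub_left (h.count_le false) n)
    have := goalFunction_add_remainingEdges (R := valueVector f) b
    have := goalFunction_add_remainingEdges (R := valueVector f) b'
    omega
  map_empty := by
    rw [goalFunction, Finset.card_eq_zero, Finset.filter_eq_empty_iff]
    intro e _
    have := e.1.2
    have := e.2.2
    simp only [Removed, count, reduceCtorEq, Finset.filter_false, Finset.card_empty]
    omega
  eq_goal_iff := fun b => by rw [goalFunction_eq_goalValue_iff, isCertificate_iff hf]

/-- The edges and their reversals are disjoint sets of ordered pairs of distinct positions, of which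
there are `(n + 1) * n`. -/
theorem goalValue_le : goalValue R ≤ n * (n + 1) / 2 := by
  rw [Nat.le_div_iff_mul_le two_pos, mul_two]
  let A : Finset (Fin (n + 1) × Fin (n + 1)) := blockEdges R
  have hA : A.card + (A.map (Equiv.prodComm _ _).toEmbedding).card ≤
      (Finset.univ : Finset (Fin (n + 1))).offDiag.card := by
    rw [← Finset.card_union_of_disjoint]
    · refine Finset.card_le_card fun e => ?_
      simp only [Finset.mem_union, Finset.mem_map_equiv, Finset.mem_offDiag, A, mem_blockEdges]
      rintro (h | h)
      · exact ⟨Finset.mem_univ _, Finset.mem_univ _, h.1.ne⟩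
      · exact ⟨Finset.mem_univ _, Finset.mem_univ _, h.1.ne'⟩
    · rw [Finset.disjoint_left]
      intro e
      simp only [Finset.mem_map_equiv, A, mem_blockEdges]
      rintro h h'
      exact lt_asymm h.1 h'.1
  rw [Finset.card_map, Finset.offDiag_card, Finset.card_univ, Fintype.card_fin] at hA
  refine hA.trans (le_of_eq ?_)
  rw [← Nat.sub_one_mul]
  simp

end Blocks
-- Extending partial assignments bit by bit
section SetBit

theorem setBit_comm {b : PartialAssignment n} {i j : Fin n} (h : i ≠ j) (l l' : Bool) :
    setBit (setBit b i l) j l' = setBit (setBit b j l') i l :=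
  Function.update_comm h _ _ _

@[simp]
theorem setBit_self (b : PartialAssignment n) (i : Fin n) (l : Bool) :
    setBit b i l i = some l :=
  Function.update_self ..

theorem setBit_of_ne {i j : Fin n} (h : j ≠ i) (b : PartialAssignment n) (l : Bool) :
    setBit b i l j = b j :=
  Function.update_of_ne h ..

theorem Extends.refl (b : PartialAssignment n) : Extends b b := fun _ _ => rfl

theorem Extends.setBit {b b' : PartialAssignment n} (h : Extends b' b) {i : Fin n}
    (hi : b' i = none) (l : Bool) : Extends (setBit b' i l) b := by
  intro j hj
  by_cases hji : j = i
  · subst hji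
    exact absurd (h j hj) (by rw [hi]; exact hj.symm)
  · rw [setBit_of_ne hji, h j hj]

theorem Extends.eq_none {b b' : PartialAssignment n} (h : Extends b' b) {i : Fin n}
    (hi : b' i = none) : b i = none := by
  by_contra hb
  exact hb (by rw [← h i hb, hi])

end SetBit

/-! ### Conditional expected cost of a decision tree -/

section Expectation

variable (c p : Fin n → ℝ)

/-- The probability that bit `i` agrees with `x`, given the partial assignment `b`. -/
noncomputable def bitWeight (b : PartialAssignment n) (x : Fin n → Bool) (i : Fin n) : ℝ :=
  match b i with
  | none => if x i then p i else 1 - p i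
  | some l => if x i = l then 1 else 0

/-- The probability of `x`, given the partial assignment `b`. -/
noncomputable def weight (b : PartialAssignment n) (x : Fin n → Bool) : ℝ :=
  ∏ i, bitWeight p b x i

theorem sum_weight (b : PartialAssignment n) : ∑ x, weight p b x = 1 := by
  let F : Fin n → Bool → ℝ := fun i v => match b i with
    | none => if v then p i else 1 - p i
    | some l => if v = l then 1 else 0
  have h : ∀ x, weight p b x = ∏ i, F i (x i) := fun x => rfl
  simp only [h]
  rw [← Fintype.prod_sum]
  refine Finset.prod_eq_one fun i _ => ?_
  simp only [F]
  rcases b i with _ | _ | _ <;> simp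

theorem weight_eq_zero {b : PartialAssignment n} {x : Fin n → Bool} {i : Fin n} {l : Bool}
    (hi : b i = some l) (hx : x i ≠ l) : weight p b x = 0 :=
  Finset.prod_eq_zero (Finset.mem_univ i) (by simp [bitWeight, hi, hx])

theorem weight_split {b : PartialAssignment n} {i : Fin n} (hi : b i = none)
    (x : Fin n → Bool) :
    weight p b x =
      p i * weight p (setBit b i true) x + (1 - p i) * weight p (setBit b i false) x := by
  unfold weight
  simp only [← Finset.mul_prod_erase _ _ (Finset.mem_univ i)]
  have h : ∀ l, ∏ j ∈ Finset.univ.erase i, bitWeight p (setBit b i l) x j =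
      ∏ j ∈ Finset.univ.erase i, bitWeight p b x j := by
    intro l
    refine Finset.prod_congr rfl fun j hj => ?_
    simp only [bitWeight, setBit_of_ne (Finset.ne_of_mem_erase hj)]
  rw [h, h]
  simp only [bitWeight, hi, setBit_self]
  cases x i <;> simp

/-- The expected cost of a tree, given the partial assignment `b`. -/
noncomputable def costGiven (b : PartialAssignment n) (T : DecisionTree n) : ℝ :=
  ∑ x, ((T.tests x).map c).sum * weight p b x

theorem expectedCost_eq_costGiven (T : DecisionTree n) :
    T.expectedCost c p = costGiven c p (fun _ => none) T := rfl

theorem costGiven_leaf (b : PartialAssignment n) (v : Bool) :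
    costGiven c p b (.leaf v) = 0 := by
  simp [costGiven, DecisionTree.tests]

/-- A test whose outcome is known is still charged: decision trees may repeat tests, and
`expectedCost` counts each repetition. `residualCost` does not. -/
theorem costGiven_node_of_some {b : PartialAssignment n} {i : Fin n} {l : Bool}
    (hi : b i = some l) (lo hi' : DecisionTree n) :
    costGiven c p b (.node i lo hi') = c i + costGiven c p b (if l then hi' else lo) := by
  have h : ∀ x, (((DecisionTree.node i lo hi').tests x).map c).sum * weight p b x =
      c i * weight p b x +
        (((if l then hi' else lo).tests x).map c).sum * weight p b x := by
    intro x
    by_cases hx : x i = l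
    · subst hx
      cases hv : x i <;> simp [DecisionTree.tests, hv, add_mul]
    · simp [weight_eq_zero p hi hx]
  unfold costGiven
  simp only [h, Finset.sum_add_distrib, ← Finset.mul_sum, sum_weight, mul_one]

theorem costGiven_split {b : PartialAssignment n} {i : Fin n} (hi : b i = none)
    (T : DecisionTree n) :
    costGiven c p b T =
      p i * costGiven c p (setBit b i true) T + (1 - p i) * costGiven c p (setBit b i false) T := by
  unfold costGiven
  simp only [Finset.mul_sum, ← Finset.sum_add_distrib]
  refine Finset.sum_congr rfl fun x _ => ?_
  rw [weight_split p hi]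
  ring

theorem costGiven_node_of_none {b : PartialAssignment n} {i : Fin n} (hi : b i = none)
    (lo hi' : DecisionTree n) :
    costGiven c p b (.node i lo hi') =
      c i + p i * costGiven c p (setBit b i true) hi' +
        (1 - p i) * costGiven c p (setBit b i false) lo := by
  rw [costGiven_split c p hi, costGiven_node_of_some c p (setBit_self b i true),
    costGiven_node_of_some c p (setBit_self b i false)]
  simp only [if_true, Bool.false_eq_true, if_false]
  ring

/-- The expected cost of the tests of a tree that are not yet answered by `b`. -/
noncomputable def residualCost : PartialAssignment n → DecisionTree n → ℝ
  | _, .leaf _ => 0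
  | b, .node i lo hi =>
    match b i with
    | some true => residualCost b hi
    | some false => residualCost b lo
    | none => c i + p i * residualCost (setBit b i true) hi +
        (1 - p i) * residualCost (setBit b i false) lo

variable {c p}

theorem residualCost_le_costGiven (hc : ∀ i, 0 < c i) (hp : ∀ i, 0 < p i ∧ p i < 1)
    (T : DecisionTree n) (b : PartialAssignment n) :
    residualCost c p b T ≤ costGiven c p b T := by
  induction T generalizing b with
  | leaf v => simp [residualCost, costGiven_leaf]
  | node i lo hi ihlo ihhi =>
    rw [residualCost]
    split
    · next h =>
      rw [costGiven_node_of_some c p h]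
      have := hc i
      have := ihhi b
      simp only [if_true]
      linarith
    · next h =>
      rw [costGiven_node_of_some c p h]
      have := hc i
      have := ihlo b
      simp only [Bool.false_eq_true, if_false]
      linarith
    · next h =>
      rw [costGiven_node_of_none c p h]
      have := hp i
      have := ihlo (setBit b i false)
      have := ihhi (setBit b i true)
      gcongr <;> linarith

/-- Greedy tests only untested variables, so none of its tests is answered in advance. -/
theorem IsAdaptiveGreedyFrom.costGiven_eq {g : PartialAssignment n → ℕ} {Q : ℕ}
    {T : DecisionTree n} {b : PartialAssignment n} (h : IsAdaptiveGreedyFrom g Q c p b T) :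
    costGiven c p b T = residualCost c p b T := by
  induction T generalizing b with
  | leaf v => simp [residualCost, costGiven_leaf]
  | node i lo hi ihlo ihhi =>
    obtain ⟨-, hi', -, hlo, hhi⟩ := h
    rw [costGiven_node_of_none c p hi', ihlo hlo, ihhi hhi]
    simp only [residualCost, hi']

/-! ### Cutting a strategy off at its test of a given variable -/

variable (c p)

/-- The expected cost, given `b`, of the tests of a tree before it tests `i`. -/
noncomputable def costBefore (i : Fin n) : PartialAssignment n → DecisionTree n → ℝ
  | _, .leaf _ => 0
  | b, .node j lo hi =>
    match b j with
    | some true => costBefore i b hi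
    | some false => costBefore i b lo
    | none => if j = i then 0 else
        c j + p j * costBefore i (setBit b j true) hi +
          (1 - p j) * costBefore i (setBit b j false) lo

/-- The probability, given `b`, that a tree tests `i`. -/
noncomputable def testProb (i : Fin n) : PartialAssignment n → DecisionTree n → ℝ
  | _, .leaf _ => 0
  | b, .node j lo hi =>
    match b j with
    | some true => testProb i b hi
    | some false => testProb i b lo
    | none => if j = i then 1 else
        p j * testProb i (setBit b j true) hi + (1 - p j) * testProb i (setBit b j false) lo

/-- Revealing `x i` in advance changes nothing except that the test of `i`, if the tree ever
performs it, becomes free. -/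
theorem residualCost_split {i : Fin n} (T : DecisionTree n) {b : PartialAssignment n}
    (hi : b i = none) :
    residualCost c p b T = testProb p i b T * c i +
      (p i * residualCost c p (setBit b i true) T +
        (1 - p i) * residualCost c p (setBit b i false) T) := by
  induction T generalizing b with
  | leaf v => simp [residualCost, testProb]
  | node j lo hi' ihlo ihhi =>
    by_cases hj : j = i
    · subst hj
      simp only [residualCost, testProb, hi, setBit_self, if_true]
      ring
    · simp only [residualCost, testProb, setBit_of_ne hj, hj, if_false]
      rcases hb : b j with _ | _ | _
      · have hi0 : setBit b j false i = none := by rw [setBit_of_ne (Ne.symm hj), hi]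
        have hi1 : setBit b j true i = none := by rw [setBit_of_ne (Ne.symm hj), hi]
        simp only [setBit_comm (Ne.symm hj)]
        rw [ihlo hi0, ihhi hi1]
        ring
      · exact ihlo hi
      · exact ihhi hi

variable {c p}

theorem costBefore_nonneg (hc : ∀ i, 0 < c i) (hp : ∀ i, 0 < p i ∧ p i < 1) (i : Fin n)
    (T : DecisionTree n) (b : PartialAssignment n) : 0 ≤ costBefore c p i b T := by
  induction T generalizing b with
  | leaf v => simp [costBefore]
  | node j lo hi ihlo ihhi =>
    rw [costBefore]
    split
    · exact ihhi _
    · exact ihlo _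
    · split
      · exact le_rfl
      · have := hc j
        have := hp j
        have := mul_nonneg (hp j).1.le (ihhi (setBit b j true))
        have := mul_nonneg (sub_nonneg.2 (hp j).2.le) (ihlo (setBit b j false))
        linarith

theorem testProb_nonneg (hp : ∀ i, 0 < p i ∧ p i < 1) (i : Fin n)
    (T : DecisionTree n) (b : PartialAssignment n) : 0 ≤ testProb p i b T := by
  induction T generalizing b with
  | leaf v => simp [testProb]
  | node j lo hi ihlo ihhi =>
    rw [testProb]
    split
    · exact ihhi _
    · exact ihlo _
    · split
      · exact zero_le_one
      · have := mul_nonneg (hp j).1.le (ihhi (setBit b j true))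
        have := mul_nonneg (sub_nonneg.2 (hp j).2.le) (ihlo (setBit b j false))
        linarith

theorem residualCost_nonneg (hc : ∀ i, 0 < c i) (hp : ∀ i, 0 < p i ∧ p i < 1)
    (T : DecisionTree n) (b : PartialAssignment n) : 0 ≤ residualCost c p b T := by
  induction T generalizing b with
  | leaf v => simp [residualCost]
  | node j lo hi ihlo ihhi =>
    rw [residualCost]
    split
    · exact ihhi _
    · exact ihlo _
    · have := hc j
      have := mul_nonneg (hp j).1.le (ihhi (setBit b j true))
      have := mul_nonneg (sub_nonneg.2 (hp j).2.le) (ihlo (setBit b j false))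
      linarith

/-- The course of the tree up to its test of `i` does not depend on `x i`, so the earlier tests are
paid for under either outcome `l`. -/
theorem costBefore_le_residualCost (hc : ∀ i, 0 < c i) (hp : ∀ i, 0 < p i ∧ p i < 1) {i : Fin n}
    (l : Bool) (T : DecisionTree n) {b : PartialAssignment n} (hi : b i = none) :
    costBefore c p i b T ≤ residualCost c p (setBit b i l) T := by
  induction T generalizing b with
  | leaf v => simp [residualCost, costBefore]
  | node j lo hi' ihlo ihhi =>
    by_cases hj : j = i
    · subst hj
      simp only [costBefore, hi, if_true]
      exact residualCost_nonneg hc hp _ _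
    · simp only [residualCost, costBefore, setBit_of_ne hj, hj, if_false]
      rcases hb : b j with _ | _ | _
      · have hi0 : setBit b j false i = none := by rw [setBit_of_ne (Ne.symm hj), hi]
        have hi1 : setBit b j true i = none := by rw [setBit_of_ne (Ne.symm hj), hi]
        simp only [setBit_comm (Ne.symm hj)]
        have h0 := mul_le_mul_of_nonneg_left (ihlo hi0) (sub_nonneg.2 (hp j).2.le)
        have h1 := mul_le_mul_of_nonneg_left (ihhi hi1) (hp j).1.le
        linarith
      · exact ihlo hi
      · exact ihhi hi

/-- Every leaf that is reached from the state `b` has utility `Q`. -/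
def Reaches (g : PartialAssignment n → ℕ) (Q : ℕ) : PartialAssignment n → DecisionTree n → Prop
  | b, .leaf _ => g b = Q
  | b, .node i lo hi =>
    match b i with
    | some true => Reaches g Q b hi
    | some false => Reaches g Q b lo
    | none => Reaches g Q (setBit b i true) hi ∧ Reaches g Q (setBit b i false) lo

/-- All inputs that arrive at a leaf get its label, so the outcomes leading there form a
certificate. -/
theorem Reaches.of_eval {f : (Fin n → Bool) → Bool} {g : PartialAssignment n → ℕ} {Q : ℕ}
    (hg : ∀ b, IsCertificate f b → g b = Q) (T : DecisionTree n) {b : PartialAssignment n}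
    (h : ∀ x : Fin n → Bool, Extends (fun i => some (x i)) b → T.eval x = f x) :
    Reaches g Q b T := by
  induction T generalizing b with
  | leaf v => exact hg b fun a a' ha ha' => by rw [← h a ha, ← h a' ha']; rfl
  | node i lo hi ihlo ihhi =>
    rw [Reaches]
    split
    · next hb =>
      refine ihhi fun x hx => ?_
      have hxi : x i = true := by simpa [hb] using hx i (by simp [hb])
      simpa [DecisionTree.eval, hxi] using h x hx
    · next hb =>
      refine ihlo fun x hx => ?_
      have hxi : x i = false := by simpa [hb] using hx i (by simp [hb])
      simpa [DecisionTree.eval, hxi] using h x hx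
    · next hb =>
      have key : ∀ (l : Bool) (x : Fin n → Bool),
          Extends (fun i => some (x i)) (setBit b i l) →
            x i = l ∧ Extends (fun i => some (x i)) b := by
        intro l x hx
        refine ⟨by simpa using hx i (by simp), fun j hj => ?_⟩
        have hji : j ≠ i := by rintro rfl; exact hj hb
        have := hx j
        rw [setBit_of_ne hji] at this
        exact this hj
      constructor
      · refine ihhi fun x hx => ?_
        obtain ⟨hxi, hx⟩ := key _ x hx
        simpa [DecisionTree.eval, hxi] using h x hx
      · refine ihlo fun x hx => ?_
        obtain ⟨hxi, hx⟩ := key _ x hx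
        simpa [DecisionTree.eval, hxi] using h x hx

/-- Run the tree from `b'` but stop it just before it tests `i`. By submodularity no test gains more
per unit cost than `ρ`, the bound valid at `b`. The final utility is `Q` if `i` is never met, and by
monotonicity at least `g b` otherwise. -/
theorem goal_le_of_reaches {g : PartialAssignment n → ℕ} {Q : ℕ} (hmono : IsMonotone g)
    (hsub : IsSubmodular g) (hp : ∀ i, 0 < p i ∧ p i < 1)
    {b : PartialAssignment n} {ρ : ℝ}
    (hρ : ∀ j, b j = none → expectedGain g p b j ≤ ρ * c j) {i : Fin n} (T : DecisionTree n)
    {b' : PartialAssignment n} (hb : Extends b' b) (hi : b' i = none) (hT : Reaches g Q b' T) :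
    (1 - testProb p i b' T) * Q + testProb p i b' T * g b ≤
      g b' + ρ * costBefore c p i b' T := by
  induction T generalizing b' with
  | leaf v =>
    have : g b' = Q := hT
    simp [testProb, costBefore, this]
  | node j lo hi' ihlo ihhi =>
    rw [Reaches] at hT
    simp only [testProb, costBefore]
    rcases hj : b' j with _ | _ | _
    · simp only [hj] at hT
      by_cases hji : j = i
      · have : (g b : ℝ) ≤ g b' := by exact_mod_cast hmono _ _ hb
        simpa [hji] using this
      · simp only [hji, if_false]
        have hbj := hb.eq_none hj
        have h1 := ihhi (hb.setBit hj true)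
          (by rw [setBit_of_ne (Ne.symm hji), hi]) hT.1
        have h0 := ihlo (hb.setBit hj false)
          (by rw [setBit_of_ne (Ne.symm hji), hi]) hT.2
        have g1 : (g (setBit b' j true) : ℝ) - g b' ≤ g (setBit b j true) - g b := by
          exact_mod_cast hsub b b' j true hb hbj hj
        have g0 : (g (setBit b' j false) : ℝ) - g b' ≤ g (setBit b j false) - g b := by
          exact_mod_cast hsub b b' j false hb hbj hj
        have hgain := hρ j hbj
        unfold expectedGain at hgain
        have hp1 := (hp j).1.le
        have hp0 := sub_nonneg.2 (hp j).2.le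
        have e1 := mul_le_mul_of_nonneg_left h1 hp1
        have e0 := mul_le_mul_of_nonneg_left h0 hp0
        have d1 := mul_le_mul_of_nonneg_left g1 hp1
        have d0 := mul_le_mul_of_nonneg_left g0 hp0
        linarith
    · simp only [hj] at hT
      exact ihlo hb hi hT
    · simp only [hj] at hT
      exact ihhi hb hi hT

/-! ### The harmonic bound for Adaptive Greedy -/

/-- Each of the `k - m` reciprocals in the difference is at least `1 / k`. -/
theorem div_le_harmonic_sub {k m : ℕ} (h : m ≤ k) :
    ((k : ℝ) - m) / k ≤ (harmonic k : ℝ) - harmonic m := by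
  induction k, h using Nat.le_induction with
  | base => simp
  | succ k hk ih =>
    rw [harmonic_succ]
    push_cast
    have hk' : (0 : ℝ) < k + 1 := by positivity
    have hkm : (m : ℝ) ≤ k := by exact_mod_cast hk
    have h1 : ((k : ℝ) - m) / (k + 1) ≤ (k - m) / k := by
      rcases Nat.eq_zero_or_pos k with rfl | hpos
      · have : (m : ℝ) = 0 := le_antisymm (by simpa using hkm) (by positivity)
        simp [this]
      · have : (0 : ℝ) < k := by exact_mod_cast hpos
        exact div_le_div_of_nonneg_left (by linarith) this (by linarith)
    have h2 : ((k : ℝ) + 1 - m) / (k + 1) = (k - m) / (k + 1) + ((k : ℝ) + 1)⁻¹ := by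
      field_simp
      ring
    rw [h2]
    linarith

theorem one_le_harmonic {k : ℕ} (h : k ≠ 0) : (1 : ℝ) ≤ harmonic k := by
  have := div_le_harmonic_sub (Nat.zero_le k)
  have hk : (k : ℝ) ≠ 0 := by exact_mod_cast h
  simpa [hk] using this

/-- The Adaptive Greedy bound for stochastic submodular cover, from an arbitrary state. -/
theorem IsAdaptiveGreedyFrom.residualCost_le {g : PartialAssignment n → ℕ} {Q : ℕ}
    (hmono : IsMonotone g) (hsub : IsSubmodular g) (hQ : ∀ b, g b ≤ Q) (hc : ∀ i, 0 < c i)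
    (hp : ∀ i, 0 < p i ∧ p i < 1) {T T' : DecisionTree n}
    (hT' : ∀ b, Reaches g Q b T') {b : PartialAssignment n}
    (hT : IsAdaptiveGreedyFrom g Q c p b T) :
    residualCost c p b T ≤ residualCost c p b T' * harmonic (Q - g b) := by
  induction T generalizing b with
  | leaf v =>
    have : g b = Q := hT
    simp [residualCost, this]
  | node i lo hi ihlo ihhi =>
    obtain ⟨hgQ, hbi, hmax, hlo, hhi⟩ := hT
    have I0 := ihlo hlo
    have I1 := ihhi hhi
    set ρ := expectedGain g p b i / c i with hρ
    have hp1 := (hp i).1.le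
    have hp0 := sub_nonneg.2 (hp i).2.le
    have ext1 := hmono _ _ ((Extends.refl b).setBit hbi true)
    have ext0 := hmono _ _ ((Extends.refl b).setBit hbi false)
    have gain1 : (0 : ℝ) ≤ g (setBit b i true) - g b := sub_nonneg.2 (by exact_mod_cast ext1)
    have gain0 : (0 : ℝ) ≤ g (setBit b i false) - g b := sub_nonneg.2 (by exact_mod_cast ext0)
    have hgain : ∀ j, b j = none → expectedGain g p b j ≤ ρ * c j := fun j hj =>
      (div_le_iff₀ (hc j)).1 (hmax j hj)
    have hreach := goal_le_of_reaches hmono hsub hp hgain T'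
      (Extends.refl b) hbi (hT' b)
    have hbefore1 := costBefore_le_residualCost hc hp true T' hbi
    have hbefore0 := costBefore_le_residualCost hc hp false T' hbi
    have hA := costBefore_nonneg hc hp i T' b
    have hsplit := residualCost_split c p T' hbi
    have hcost : residualCost c p b (.node i lo hi) = c i +
        p i * residualCost c p (setBit b i true) hi +
          (1 - p i) * residualCost c p (setBit b i false) lo := by
      simp only [residualCost, hbi]
    have hlt : g b < Q := lt_of_le_of_ne (hQ b) hgQ
    have hH : (1 : ℝ) ≤ harmonic (Q - g b) := one_le_harmonic (by omega)
    have hdrop : ∀ l, ((g (setBit b i l) : ℝ) - g b) / ((Q : ℝ) - g b) ≤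
        (harmonic (Q - g b) : ℝ) - harmonic (Q - g (setBit b i l)) := by
      intro l
      have hl : g b ≤ g (setBit b i l) := hmono _ _ ((Extends.refl b).setBit hbi l)
      have := div_le_harmonic_sub (show Q - g (setBit b i l) ≤ Q - g b by omega)
      rw [Nat.cast_sub (hQ _), Nat.cast_sub (hQ _)] at this
      convert this using 2
      ring
    have d1 := hdrop true
    have d0 := hdrop false
    have hπ1 : 0 ≤ testProb p i b T' := testProb_nonneg hp i T' b
    rw [hcost]
    set A := costBefore c p i b T'
    set A1 := residualCost c p (setBit b i true) T'
    set A0 := residualCost c p (setBit b i false) T'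
    set H := (harmonic (Q - g b) : ℝ)
    set H1 := (harmonic (Q - g (setBit b i true)) : ℝ)
    set H0 := (harmonic (Q - g (setBit b i false)) : ℝ)
    set π := testProb p i b T'
    have hR : (0 : ℝ) < Q - g b := sub_pos.2 (by exact_mod_cast hlt)
    -- `hreach` compares `T'` from the very state `b` in which greedy chooses, so both reference
    -- utilities are `g b`.
    have hR1 : (1 - π) * ((Q : ℝ) - g b) ≤ ρ * A := by linarith
    -- The share of `c i` not covered by the test of `i` in `T'` is covered by the drop of the
    -- harmonic factor. Replacing `A1` and `A0` by the common lower bound `A` makes the expected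
    -- gain `ρ * c i` appear.
    have key : (1 - π) * c i ≤ p i * (A1 * (H - H1)) + (1 - p i) * (A0 * (H - H0)) := by
      have k1 : A * ((g (setBit b i true) - g b) / ((Q : ℝ) - g b)) ≤ A1 * (H - H1) :=
        mul_le_mul hbefore1 d1 (div_nonneg gain1 hR.le) (hA.trans hbefore1)
      have k0 : A * ((g (setBit b i false) - g b) / ((Q : ℝ) - g b)) ≤ A0 * (H - H0) :=
        mul_le_mul hbefore0 d0 (div_nonneg gain0 hR.le) (hA.trans hbefore0)
      have hk := add_le_add (mul_le_mul_of_nonneg_left k1 hp1) (mul_le_mul_of_nonneg_left k0 hp0)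
      refine le_trans ?_ hk
      have e : p i * (A * ((g (setBit b i true) - g b) / ((Q : ℝ) - g b))) +
          (1 - p i) * (A * ((g (setBit b i false) - g b) / ((Q : ℝ) - g b))) =
          A * (ρ * c i) / ((Q : ℝ) - g b) := by
        rw [hρ, div_mul_cancel₀ _ (hc i).ne', expectedGain]
        ring
      rw [e, le_div_iff₀ hR]
      nlinarith [hc i]
    have m1 := mul_le_mul_of_nonneg_left I1 hp1
    have m0 := mul_le_mul_of_nonneg_left I0 hp0
    rw [hsplit]
    have hπc : π * c i ≤ π * c i * H := le_mul_of_one_le_right (mul_nonneg hπ1 (hc i).le) hH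
    nlinarith

/-- The comparison is started in the empty state, where `g` is zero. Repeated tests only make `T'`
dearer, and greedy has none. -/
theorem IsAdaptiveGreedy.expectedCost_le {f : (Fin n → Bool) → Bool}
    {g : PartialAssignment n → ℕ} {Q : ℕ} (hg : IsGoalFunction f g Q) (hc : ∀ i, 0 < c i)
    (hp : ∀ i, 0 < p i ∧ p i < 1) {T T' : DecisionTree n} (hT : IsAdaptiveGreedy g Q c p T)
    (hT' : T'.Computes f) :
    T.expectedCost c p ≤ harmonic Q * T'.expectedCost c p := by
  -- Any completion of `b` to a full assignment is a certificate, hence has utility `Q`, and `g` is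
  -- monotone.
  have hQ : ∀ b, g b ≤ Q := by
    intro b
    have hx : ∀ i, ∃ l : Bool, ∀ v, b i = some v → l = v := fun i => by
      rcases b i with _ | v
      · exact ⟨true, by simp⟩
      · exact ⟨v, by simp⟩
    choose x hx using hx
    have : g (fun i => some (x i)) = Q := by
      rw [hg.eq_goal_iff]
      intro a a' ha ha'
      congr 1
      ext1 i
      have h1 := ha i (by simp)
      have h2 := ha' i (by simp)
      simp only [Option.some.injEq] at h1 h2
      rw [h1, h2]
    rw [← this]
    refine hg.monotone _ _ fun i hi => ?_
    obtain ⟨v, hv⟩ := Option.ne_none_iff_exists'.1 hi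
    rw [hv, hx i v hv]
  have h := IsAdaptiveGreedyFrom.residualCost_le hg.monotone hg.submodular hQ hc hp
    (T' := T') (fun b => Reaches.of_eval (fun b => (hg.eq_goal_iff b).2) T' fun x _ => hT' x) hT
  rw [expectedCost_eq_costGiven, expectedCost_eq_costGiven, IsAdaptiveGreedyFrom.costGiven_eq hT]
  rw [hg.map_empty, Nat.sub_zero] at h
  refine h.trans ?_
  rw [mul_comm]
  refine mul_le_mul_of_nonneg_left (residualCost_le_costGiven hc hp _ _) ?_
  exact_mod_cast (by unfold harmonic; positivity : (0 : ℚ) ≤ harmonic Q)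

theorem harmonic_le_mul_log {Q : ℕ} (hn : 2 ≤ n) (hQ : Q ≤ n * (n + 1) / 2) :
    (harmonic Q : ℝ) ≤ 4 * Real.log n := by
  have hn' : (2 : ℝ) ≤ n := by exact_mod_cast hn
  have hlog2 : (1 : ℝ) / 2 ≤ Real.log n := by
    have := Real.log_two_gt_d9
    have := Real.log_le_log (by norm_num) hn'
    linarith
  -- The constant 4 arises from `1 + log Q ≤ 1 + 2 log n` together with `1 ≤ 2 log n`, which needs
  -- `2 ≤ n`.
  refine (harmonic_le_one_add_log Q).trans ?_
  rcases Nat.eq_zero_or_pos Q with rfl | hpos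
  · simp; linarith
  have hQn : (Q : ℝ) ≤ (n : ℝ) ^ 2 := by
    have : Q ≤ n ^ 2 := hQ.trans (Nat.div_le_of_le_mul (by nlinarith))
    exact_mod_cast this
  have := Real.log_le_log (by exact_mod_cast hpos) hQn
  rw [Real.log_pow] at this
  push_cast at this
  linarith

end Expectation
-- Computing the gains and the best ratio by linear scans
section Scanning

variable (w : List ℕ)

/-- The number of positions `u` among the `k` positions after `s` such that the value vector stored
in `w` is not constant from `s` to `u`. -/
def scanUp (s : ℕ) : ℕ → ℕ
  | 0 => 0
  | k + 1 =>
    if scanUp s k + ((w.getD (1 + (s + (k + 1))) 0 - w.getD (1 + s) 0) +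
        (w.getD (1 + s) 0 - w.getD (1 + (s + (k + 1))) 0)) ≠ 0
    then scanUp s k + 1 else scanUp s k

/-- The number of positions `u` among the `k` positions before `t` such that the value vector stored
in `w` is not constant from `u` to `t`. -/
def scanDown (t : ℕ) : ℕ → ℕ
  | 0 => 0
  | k + 1 =>
    if scanDown t k + ((w.getD (1 + (t - (k + 1))) 0 - w.getD (1 + t) 0) +
        (w.getD (1 + t) 0 - w.getD (1 + (t - (k + 1))) 0)) ≠ 0
    then scanDown t k + 1 else scanDown t k

/-- A linear search for an index `j` with `flag j = 0` that maximizes `num j / den j`. The state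
consists of the index found so far, its numerator, and its denominator. -/
def scanBest (flag num den : ℕ → ℕ) : ℕ → ℕ × ℕ × ℕ
  | 0 => (0, 0, 1)
  | k + 1 =>
    if flag k ≠ 0 then scanBest flag num den k
    else if num k * (scanBest flag num den k).2.2 - (scanBest flag num den k).2.1 * den k ≠ 0
    then (k, num k, den k) else scanBest flag num den k

theorem scanUp_le (s k : ℕ) : scanUp w s k ≤ k := by
  induction k with
  | zero => rfl
  | succ k ih => rw [scanUp]; split <;> omega

theorem scanDown_le (t k : ℕ) : scanDown w t k ≤ k := by
  induction k with
  | zero => rfl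
  | succ k ih => rw [scanDown]; split <;> omega

variable {w}

/-- A new position is joined to `s` iff its own value differs from that at `s` or the vector has
changed before, i.e. the count is already nonzero. The two truncated differences add up to the
distance of the two values. -/
theorem scanUp_eq_upGain {R : Fin (n + 1) → Bool}
    (hw : ∀ j : Fin (n + 1), w.getD (1 + j) 0 = (R j).toNat) {s k : ℕ} (h : s + k ≤ n) :
    scanUp w s k = upGain R s (s + k) := by
  induction k with
  | zero =>
    symm
    rw [scanUp, upGain, Finset.card_eq_zero, Finset.filter_eq_empty_iff]
    intro e he
    have := (mem_blockEdges.1 he).1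
    rw [Fin.lt_def] at this
    omega
  | succ k ih =>
    specialize ih (by omega)
    let u : Fin (n + 1) := ⟨s, by omega⟩
    let v : Fin (n + 1) := ⟨s + (k + 1), by omega⟩
    have hu : w.getD (1 + s) 0 = (R u).toNat := hw u
    have hv : w.getD (1 + (s + (k + 1))) 0 = (R v).toNat := hw v
    have hstep : upGain R s (s + (k + 1)) =
        upGain R s (s + k) + if (u, v) ∈ blockEdges R then 1 else 0 := by
      have : ((blockEdges R).filter fun e => (e.1 : ℕ) = s ∧ (e.2 : ℕ) ≤ s + (k + 1)) =
          ((blockEdges R).filter fun e => (e.1 : ℕ) = s ∧ (e.2 : ℕ) ≤ s + k) ∪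
            if (u, v) ∈ blockEdges R then {(u, v)} else ∅ := by
        ext e
        have huv : e = (u, v) ↔ (e.1 : ℕ) = s ∧ (e.2 : ℕ) = s + (k + 1) := by
          rw [Prod.ext_iff, Fin.ext_iff, Fin.ext_iff]
        by_cases he : e = (u, v)
        · by_cases hm : (u, v) ∈ blockEdges R
          · simp [he, hm, u, v]
          · simp [he, hm]
        · have : e ∉ if (u, v) ∈ blockEdges R then ({(u, v)} : Finset _) else ∅ := by
            split <;> simp [he]
          rw [Finset.mem_union, or_iff_left this]
          rw [huv] at he
          simp only [Finset.mem_filter]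
          exact and_congr_right fun _ => by omega
      rw [upGain, this, Finset.card_union_of_disjoint]
      · rw [upGain]
        split <;> simp
      · split
        · simp [u, v]
        · simp
    have hedge : (u, v) ∈ blockEdges R ↔ upGain R s (s + k) ≠ 0 ∨ R v ≠ R u := by
      rw [upGain, ← Nat.pos_iff_ne_zero, Finset.card_pos]
      constructor
      · intro h
        obtain ⟨-, l, h1, h2, h3⟩ := mem_blockEdges.1 h
        by_cases hl : l = v
        · right
          rwa [← hl]
        · left
          have hul : u ≠ l := by rintro rfl; exact h3 rfl
          refine ⟨(u, l), Finset.mem_filter.2 ⟨mem_blockEdges.2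
            ⟨lt_of_le_of_ne h1 hul, l, h1, le_rfl, h3⟩, rfl, ?_⟩⟩
          have h4 : (l : ℕ) ≤ s + (k + 1) := h2
          have h5 : (l : ℕ) ≠ s + (k + 1) := fun h => hl (Fin.ext h)
          change (l : ℕ) ≤ _
          omega
      · have huv : u < v := by simp [u, v, Fin.lt_def]
        rintro (⟨e, he⟩ | h)
        · obtain ⟨h1, h2, h3⟩ := Finset.mem_filter.1 he
          obtain ⟨h4, l, h5, h6, h7⟩ := mem_blockEdges.1 h1
          have he1 : e.1 = u := Fin.ext h2
          rw [he1] at h5 h7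
          refine mem_blockEdges.2 ⟨huv, l, h5, ?_, h7⟩
          rw [Fin.le_def] at h6
          change (l : ℕ) ≤ s + (k + 1)
          omega
        · exact mem_blockEdges.2 ⟨huv, v, huv.le, le_rfl, h⟩
    rw [scanUp, ih, hstep, hu, hv]
    have hR : ((R v).toNat - (R u).toNat + ((R u).toNat - (R v).toNat) ≠ 0) ↔ R v ≠ R u := by
      cases R v <;> cases R u <;> simp
    by_cases hm : (u, v) ∈ blockEdges R
    · rw [if_pos hm, if_pos]
      have := hedge.1 hm
      rw [← hR] at this
      omega
    · rw [if_neg hm, if_neg, add_zero]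
      have := mt hedge.2 hm
      rw [← hR] at this
      omega

theorem scanDown_eq_downGain {R : Fin (n + 1) → Bool}
    (hw : ∀ j : Fin (n + 1), w.getD (1 + j) 0 = (R j).toNat) {t k : ℕ} (h : k ≤ t) (ht : t ≤ n) :
    scanDown w t k = downGain R (t - k) t := by
  induction k with
  | zero =>
    symm
    rw [scanDown, downGain, Finset.card_eq_zero, Finset.filter_eq_empty_iff]
    intro e he
    have := (mem_blockEdges.1 he).1
    rw [Fin.lt_def] at this
    omega
  | succ k ih =>
    specialize ih (by omega)
    let u : Fin (n + 1) := ⟨t - (k + 1), by omega⟩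
    let v : Fin (n + 1) := ⟨t, by omega⟩
    have hu : w.getD (1 + (t - (k + 1))) 0 = (R u).toNat := hw u
    have hv : w.getD (1 + t) 0 = (R v).toNat := hw v
    have hstep : downGain R (t - (k + 1)) t =
        downGain R (t - k) t + if (u, v) ∈ blockEdges R then 1 else 0 := by
      have : ((blockEdges R).filter fun e => t - (k + 1) ≤ (e.1 : ℕ) ∧ (e.2 : ℕ) = t) =
          ((blockEdges R).filter fun e => t - k ≤ (e.1 : ℕ) ∧ (e.2 : ℕ) = t) ∪
            if (u, v) ∈ blockEdges R then {(u, v)} else ∅ := by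
        ext e
        have huv : e = (u, v) ↔ (e.1 : ℕ) = t - (k + 1) ∧ (e.2 : ℕ) = t := by
          rw [Prod.ext_iff, Fin.ext_iff, Fin.ext_iff]
        by_cases he : e = (u, v)
        · by_cases hm : (u, v) ∈ blockEdges R
          · simp only [he, hm, u, v, Finset.mem_filter, if_true, Finset.mem_union,
              Finset.mem_singleton]
            simp
          · simp [he, hm]
        · have : e ∉ if (u, v) ∈ blockEdges R then ({(u, v)} : Finset _) else ∅ := by
            split <;> simp [he]
          rw [Finset.mem_union, or_iff_left this]
          rw [huv] at he
          simp only [Finset.mem_filter]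
          exact and_congr_right fun _ => by omega
      rw [downGain, this, Finset.card_union_of_disjoint]
      · rw [downGain]
        split <;> simp
      · split
        · simp only [Finset.disjoint_singleton_right, Finset.mem_filter, u, v]
          omega
        · simp
    have huv : u < v := by
      change t - (k + 1) < t
      omega
    have hedge : (u, v) ∈ blockEdges R ↔ downGain R (t - k) t ≠ 0 ∨ R u ≠ R v := by
      rw [downGain, ← Nat.pos_iff_ne_zero, Finset.card_pos]
      constructor
      · intro h
        -- The definition of an edge compares with the lower end, the scan with the upper end `t`.
        -- If both ends agree, the differing position `l` lies strictly between them and is itself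
        -- joined to `t`.
        by_cases hR : R u = R v
        · left
          obtain ⟨-, l, h1, h2, h3⟩ := mem_blockEdges.1 h
          have hul : u ≠ l := by rintro rfl; exact h3 rfl
          have hlv : l ≠ v := by rintro rfl; exact h3 hR.symm
          refine ⟨(l, v), Finset.mem_filter.2 ⟨mem_blockEdges.2
            ⟨lt_of_le_of_ne h2 hlv, v, h2, le_rfl, ?_⟩, ?_, rfl⟩⟩
          · change R v ≠ R l
            rw [← hR]
            exact h3.symm
          · have h4 : t - (k + 1) ≤ (l : ℕ) := h1
            have h5 : t - (k + 1) ≠ (l : ℕ) := fun h => hul (Fin.ext h)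
            change _ ≤ (l : ℕ)
            omega
        · exact Or.inr hR
      · rintro (⟨e, he⟩ | h)
        · obtain ⟨h1, h2, h3⟩ := Finset.mem_filter.1 he
          obtain ⟨h4, l, h5, h6, h7⟩ := mem_blockEdges.1 h1
          have he2 : e.2 = v := Fin.ext h3
          rw [he2] at h6
          have hue : u ≤ e.1 := by
            change t - (k + 1) ≤ (e.1 : ℕ)
            omega
          by_cases hR : R e.1 = R u
          · exact mem_blockEdges.2 ⟨huv, l, hue.trans h5, h6, by rwa [← hR]⟩
          · exact mem_blockEdges.2 ⟨huv, e.1, hue, h5.trans h6, hR⟩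
        · exact mem_blockEdges.2 ⟨huv, v, huv.le, le_rfl, h.symm⟩
    rw [scanDown, ih, hstep, hu, hv]
    have hR : ((R u).toNat - (R v).toNat + ((R v).toNat - (R u).toNat) ≠ 0) ↔ R u ≠ R v := by
      cases R v <;> cases R u <;> simp
    by_cases hm : (u, v) ∈ blockEdges R
    · rw [if_pos hm, if_pos]
      have := hedge.1 hm
      rw [← hR] at this
      omega
    · rw [if_neg hm, if_neg, add_zero]
      have := mt hedge.2 hm
      rw [← hR] at this
      omega

/-- If `s` is joined to nothing up to `t`, the vector is constant there. So one scan also decides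
whether the goal is reached. -/
theorem upGain_eq_zero_iff {R : Fin (n + 1) → Bool} {s t : ℕ} :
    upGain R s t = 0 ↔ remainingEdges R s t = 0 := by
  rw [remainingEdges_eq_zero_iff, upGain, Finset.card_eq_zero, Finset.filter_eq_empty_iff]
  constructor
  · intro h u v hu huv hv
    have hconst : ∀ l : Fin (n + 1), s ≤ l → (l : ℕ) ≤ t → R l = R ⟨s, by omega⟩ := by
      intro l h1 h2
      by_contra hne
      have hlt : (⟨s, by omega⟩ : Fin (n + 1)) < l :=
        lt_of_le_of_ne h1 fun h => hne (by rw [h])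
      exact h (x := (⟨s, by omega⟩, l)) (mem_blockEdges.2 ⟨hlt, l, h1, le_rfl, hne⟩) ⟨rfl, h2⟩
    rw [Fin.le_def] at huv
    rw [hconst u hu (by omega), hconst v (by omega) hv]
  · rintro h e he ⟨h1, h2⟩
    obtain ⟨_, k, h3, h4, h5⟩ := mem_blockEdges.1 he
    exact h5 (h e.1 k h1.ge h3 (le_trans h4 h2))

theorem scanBest_den_pos {flag num den : ℕ → ℕ} {N : ℕ} (hden : ∀ j < N, 0 < den j) :
    0 < (scanBest flag num den N).2.2 := by
  induction N with
  | zero => exact one_pos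
  | succ k ih =>
    have := ih fun j hj => hden j (by omega)
    rw [scanBest]
    split_ifs
    exacts [this, hden k (by omega), this]

theorem scanBest_eq (flag num den : ℕ → ℕ) (N : ℕ) :
    scanBest flag num den N = (0, 0, 1) ∨
      ((scanBest flag num den N).1 < N ∧ flag (scanBest flag num den N).1 = 0 ∧
        (scanBest flag num den N).2 =
          (num (scanBest flag num den N).1, den (scanBest flag num den N).1)) := by
  induction N with
  | zero => exact Or.inl rfl
  | succ k ih =>
    have ih' := ih.imp_right fun h => (⟨h.1.trans (Nat.lt_succ_self k), h.2⟩ :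
      (scanBest flag num den k).1 < k + 1 ∧ _)
    rw [scanBest]
    split_ifs with h1 h2
    exacts [ih', Or.inr ⟨Nat.lt_succ_self k, not_not.1 h1, rfl⟩, ih']

/-- The ratios are compared by cross multiplication; positive denominators make this comparison
transitive. -/
theorem le_scanBest {flag num den : ℕ → ℕ} {N : ℕ} (hden : ∀ j < N, 0 < den j) {j : ℕ}
    (hj : j < N) (hf : flag j = 0) :
    num j * (scanBest flag num den N).2.2 ≤ (scanBest flag num den N).2.1 * den j := by
  induction N with
  | zero => omega
  | succ k ih =>
    have hden' : ∀ j < k, 0 < den j := fun j hj => hden j (by omega)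
    have hD := scanBest_den_pos (flag := flag) (num := num) hden'
    rcases Nat.lt_succ_iff_lt_or_eq.1 hj with hjk | rfl
    · have ih' := ih hden' hjk
      rw [scanBest]
      split_ifs with h1 h2
      · exact ih'
      · have h3 : (scanBest flag num den k).2.1 * den k <
            num k * (scanBest flag num den k).2.2 := by omega
        refine le_of_mul_le_mul_right ?_ hD
        calc num j * den k * (scanBest flag num den k).2.2
            = num j * (scanBest flag num den k).2.2 * den k := by ring
          _ ≤ (scanBest flag num den k).2.1 * den j * den k := by gcongr
          _ = (scanBest flag num den k).2.1 * den k * den j := by ring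
          _ ≤ num k * (scanBest flag num den k).2.2 * den j := by gcongr
          _ = num k * den j * (scanBest flag num den k).2.2 := by ring
      · exact ih'
    · rw [scanBest, if_neg (by simp [hf])]
      split_ifs with h2
      · exact le_rfl
      · omega

end Scanning

/-! ### The greedy tree read off from an input list -/

section Strategy

variable (w : List ℕ)

/-- Whether variable `j` is tested in the state `b`, as a number. -/
def testedFlag (b : PartialAssignment n) (j : ℕ) : ℕ :=
  if h : j < n then (b ⟨j, h⟩).isSome.toNat else 0

/-- The numerator of the gain per unit cost of variable `j`, computed from the input `w`, where
`u` and `d` are the increases of the utility for the outcomes one and zero. -/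
def ratioNum (n u d j : ℕ) : ℕ :=
  (w.getD (n + n + n + 2 + j) 0 * u +
    (w.getD (n + n + n + n + 2 + j) 0 - w.getD (n + n + n + 2 + j) 0) * d) *
      w.getD (n + n + 2 + j) 0

/-- The denominator of the gain per unit cost of variable `j`. -/
def ratioDen (n j : ℕ) : ℕ := w.getD (n + n + n + n + 2 + j) 0 * w.getD (n + 2 + j) 0

/-- The increase of the utility, computed from the input `w`, if a variable with value one is
tested in the state `b`. -/
def gainOne (b : PartialAssignment n) : ℕ :=
  scanUp w (count true b) (n - count false b - count true b)

/-- The increase of the utility, computed from the input `w`, if a variable with value zero is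
tested in the state `b`. -/
def gainZero (b : PartialAssignment n) : ℕ :=
  scanDown w (n - count false b) (n - count false b - count true b)

/-- The result of the search for the best variable in the state `b`. -/
def searchBest (b : PartialAssignment n) (k : ℕ) : ℕ × ℕ × ℕ :=
  scanBest (testedFlag b) (ratioNum w n (gainOne w b) (gainZero w b)) (ratioDen w n) k

/-- The Adaptive Greedy strategy computed from the input `w`, with at most the given number of
further tests. -/
def greedyTree : ℕ → PartialAssignment n → DecisionTree n
  | 0, b => .leaf (decide (w.getD (1 + count true b) 0 = 1))
  | k + 1, b =>
    if gainOne w b = 0 then .leaf (decide (w.getD (1 + count true b) 0 = 1))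
    else if h : (searchBest w b n).1 < n then
      .node ⟨_, h⟩ (greedyTree k (setBit b ⟨_, h⟩ false)) (greedyTree k (setBit b ⟨_, h⟩ true))
    else .leaf (decide (w.getD (1 + count true b) 0 = 1))

/-- The conditions on an input of the evaluation problem that the search for the best variable
depends on. -/
structure ValidInput (n : ℕ) (w : List ℕ) : Prop where
  size_eq : w.getD 0 0 = n
  value_le : ∀ j ≤ n, w.getD (1 + j) 0 ≤ 1
  costNum_pos : ∀ j < n, 0 < w.getD (n + 2 + j) 0
  costDen_pos : ∀ j < n, 0 < w.getD (n + n + 2 + j) 0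
  probNum_pos : ∀ j < n, 0 < w.getD (n + n + n + 2 + j) 0
  probDen_pos : ∀ j < n, 0 < w.getD (n + n + n + n + 2 + j) 0

variable {w}

theorem testedFlag_eq_zero_iff {b : PartialAssignment n} {j : Fin n} :
    testedFlag b j = 0 ↔ b j = none := by
  simp only [testedFlag, j.2, dif_pos]
  rcases b j with _ | _ <;> simp

theorem testedFlag_setBit (b : PartialAssignment n) (i : Fin n) (l : Bool) (j : ℕ) :
    testedFlag (setBit b i l) j = if j = i then 1 else testedFlag b j := by
  unfold testedFlag
  by_cases h : j < n
  · by_cases hj : j = i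
    · subst hj
      simp
    · have : (⟨j, h⟩ : Fin n) ≠ i := fun e => hj (congrArg Fin.val e)
      simp [h, hj, setBit_of_ne this]
  · have : j ≠ i := by omega
    simp [h, this]

theorem exists_untested {b : PartialAssignment n} (h : gainOne w b ≠ 0) :
    ∃ i, b i = none := by
  by_contra! hb
  have h1 := count_add_count b
  rw [Finset.filter_eq_empty_iff.2 fun i _ => hb i, Finset.card_empty] at h1
  refine h ?_
  rw [gainOne, show n - count false b - count true b = 0 by omega]
  rfl

theorem ValidInput.ratioDen_pos (hw : ValidInput n w) : ∀ j < n, 0 < ratioDen w n j :=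
  fun j hj => Nat.mul_pos (hw.probDen_pos j hj) (hw.costNum_pos j hj)

theorem ValidInput.searchBest_spec (hw : ValidInput n w) {b : PartialAssignment n}
    (h : gainOne w b ≠ 0) :
    (searchBest w b n).1 < n ∧ testedFlag b (searchBest w b n).1 = 0 ∧
      (searchBest w b n).2 = (ratioNum w n (gainOne w b) (gainZero w b) (searchBest w b n).1,
        ratioDen w n (searchBest w b n).1) := by
  refine (scanBest_eq _ _ _ n).resolve_left fun h0 => ?_
  obtain ⟨i, hi⟩ := exists_untested h
  have hle := le_scanBest (num := ratioNum w n (gainOne w b) (gainZero w b))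
    hw.ratioDen_pos i.2 (testedFlag_eq_zero_iff.2 hi)
  rw [h0] at hle
  -- The outcome one alone already gives an untested variable a positive ratio, so it beats the
  -- initial dummy `(0, 0, 1)` of the search.
  have : 0 < ratioNum w n (gainOne w b) (gainZero w b) i := by
    refine Nat.mul_pos (Nat.add_pos_left ?_ _) (hw.costDen_pos i i.2)
    exact Nat.mul_pos (hw.probNum_pos i i.2) (Nat.pos_of_ne_zero h)
  simp only [mul_one, zero_mul] at hle
  omega

theorem ValidInput.greedyTree_succ (hw : ValidInput n w) {b : PartialAssignment n}
    (h : gainOne w b ≠ 0) (k : ℕ) :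
    greedyTree w (k + 1) b = .node ⟨_, (hw.searchBest_spec h).1⟩
      (greedyTree w k (setBit b ⟨_, (hw.searchBest_spec h).1⟩ false))
      (greedyTree w k (setBit b ⟨_, (hw.searchBest_spec h).1⟩ true)) := by
  rw [greedyTree, if_neg h, dif_pos]

theorem greedyTree_of_gainOne_eq_zero {b : PartialAssignment n} (h : gainOne w b = 0) (k : ℕ) :
    greedyTree w k b = .leaf (decide (w.getD (1 + count true b) 0 = 1)) := by
  cases k with
  | zero => rw [greedyTree]
  | succ k => rw [greedyTree, if_pos h]

end Strategy

/-! ### The encoded instance, and correctness of the computed tree -/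

section Encoding

theorem getD_append_ofFn (l l' : List ℕ) (N : ℕ) (a : Fin N → ℕ) (j : Fin N) (k : ℕ)
    (hk : k = l.length + j) : (l ++ List.ofFn a ++ l').getD k 0 = a j := by
  subst hk
  have h1 : l.length + (j : ℕ) < (l ++ List.ofFn a).length := by simp
  rw [List.getD_append _ _ _ _ h1, List.getD_append_right _ _ _ _ (Nat.le_add_right _ _)]
  simp

variable (R : Fin (n + 1) → Bool) (c p : Fin n → ℚ)

theorem encodeInstance_value (j : Fin (n + 1)) :
    (encodeInstance R c p).getD (1 + j) 0 = (R j).toNat := by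
  unfold encodeInstance
  simp only [List.append_assoc]
  rw [← List.append_assoc]
  exact getD_append_ofFn [n] _ _ _ j _ (by simp)

theorem encodeInstance_costNum (j : Fin n) :
    (encodeInstance R c p).getD (n + 2 + j) 0 = (c j).num.toNat := by
  unfold encodeInstance
  rw [List.append_assoc, List.append_assoc]
  exact getD_append_ofFn _ _ _ (fun i => (c i).num.toNat) j _ (by simp)

theorem encodeInstance_costDen (j : Fin n) :
    (encodeInstance R c p).getD (n + n + 2 + j) 0 = (c j).den := by
  unfold encodeInstance
  rw [List.append_assoc]
  exact getD_append_ofFn _ _ _ (fun i => (c i).den) j _ (by simp)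

theorem encodeInstance_probNum (j : Fin n) :
    (encodeInstance R c p).getD (n + n + n + 2 + j) 0 = (p j).num.toNat := by
  unfold encodeInstance
  exact getD_append_ofFn _ _ _ (fun i => (p i).num.toNat) j _ (by simp; omega)

theorem encodeInstance_probDen (j : Fin n) :
    (encodeInstance R c p).getD (n + n + n + n + 2 + j) 0 = (p j).den := by
  unfold encodeInstance
  rw [← List.append_nil (_ ++ List.ofFn fun i => (p i).den)]
  exact getD_append_ofFn _ _ _ (fun i => (p i).den) j _ (by simp; omega)

variable {R c p}

theorem validInput_encodeInstance (hc : ∀ i, 0 < c i) (hp : ∀ i, 0 < p i ∧ p i < 1) :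
    ValidInput n (encodeInstance R c p) where
  size_eq := rfl
  value_le j hj := by
    rw [encodeInstance_value R c p ⟨j, by omega⟩]
    exact Bool.toNat_le _
  costNum_pos j hj := by
    rw [encodeInstance_costNum R c p ⟨j, hj⟩]
    have := Rat.num_pos.2 (hc ⟨j, hj⟩)
    omega
  costDen_pos j hj := by
    rw [encodeInstance_costDen R c p ⟨j, hj⟩]
    exact Rat.den_pos _
  probNum_pos j hj := by
    rw [encodeInstance_probNum R c p ⟨j, hj⟩]
    have := Rat.num_pos.2 (hp ⟨j, hj⟩).1
    omega
  probDen_pos j hj := by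
    rw [encodeInstance_probDen R c p ⟨j, hj⟩]
    exact Rat.den_pos _

theorem gainOne_encodeInstance (b : PartialAssignment n) :
    gainOne (encodeInstance R c p) b = upGain R (count true b) (n - count false b) := by
  have := count_add_count_le b
  rw [gainOne, scanUp_eq_upGain (encodeInstance_value R c p) (by omega)]
  congr 1
  omega

theorem gainZero_encodeInstance (b : PartialAssignment n) :
    gainZero (encodeInstance R c p) b = downGain R (count true b) (n - count false b) := by
  have := count_add_count_le b
  rw [gainZero, scanDown_eq_downGain (encodeInstance_value R c p) (by omega) (by omega)]
  congr 1
  omega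

theorem gainOne_eq_zero_iff (b : PartialAssignment n) :
    gainOne (encodeInstance R c p) b = 0 ↔ goalFunction R b = goalValue R := by
  rw [gainOne_encodeInstance, upGain_eq_zero_iff, goalFunction_eq_goalValue_iff]

/-- With `p i = a / a'` and `c i = r / r'`, clearing denominators gives `(a u + (a' - a) d) r' / (a'
r)`. Since `p i < 1`, the truncated difference `a' - a` is the true one. -/
theorem expectedGain_div_cost (hc : ∀ i, 0 < c i) (hp : ∀ i, 0 < p i ∧ p i < 1)
    {b : PartialAssignment n} {i : Fin n} (hi : b i = none) :
    expectedGain (goalFunction R) (fun i => (p i : ℝ)) b i / (c i : ℝ) =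
      (ratioNum (encodeInstance R c p) n (gainOne (encodeInstance R c p) b)
        (gainZero (encodeInstance R c p) b) i : ℝ) / ratioDen (encodeInstance R c p) n i := by
  have hcn := Rat.num_pos.2 (hc i)
  have hpn := Rat.num_pos.2 (hp i).1
  have hpd : (p i).num < (p i).den := by
    have := (hp i).2
    exact Rat.num_lt_denom_iff.2 this
  rw [gainOne_encodeInstance, gainZero_encodeInstance]
  unfold expectedGain ratioNum ratioDen
  rw [goalFunction_setBit_true hi, goalFunction_setBit_false hi, encodeInstance_costNum,
    encodeInstance_costDen, encodeInstance_probNum, encodeInstance_probDen]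
  have hpr : (p i : ℝ) = ((p i).num.toNat : ℝ) / (p i).den := by
    rw [Rat.cast_def]
    congr 1
    exact_mod_cast (Int.toNat_of_nonneg hpn.le).symm
  have hcr : (c i : ℝ) = ((c i).num.toNat : ℝ) / (c i).den := by
    rw [Rat.cast_def]
    congr 1
    exact_mod_cast (Int.toNat_of_nonneg hcn.le).symm
  simp only [hpr, hcr]
  push_cast [show (p i).num.toNat ≤ (p i).den by omega]
  have h1 : ((p i).den : ℝ) ≠ 0 := by exact_mod_cast (p i).den_nz
  have h2 : ((c i).den : ℝ) ≠ 0 := by exact_mod_cast (c i).den_nz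
  have h3 : ((c i).num.toNat : ℝ) ≠ 0 := by
    have : (c i).num.toNat ≠ 0 := by omega
    exact_mod_cast this
  field_simp
  ring

theorem greedyTree_isAdaptiveGreedyFrom (hc : ∀ i, 0 < c i) (hp : ∀ i, 0 < p i ∧ p i < 1)
    (k : ℕ) {b : PartialAssignment n} (hk : (Finset.univ.filter fun i => b i = none).card ≤ k) :
    IsAdaptiveGreedyFrom (goalFunction R) (goalValue R) (fun i => (c i : ℝ)) (fun i => (p i : ℝ))
      b (greedyTree (encodeInstance R c p) k b) := by
  have hw := validInput_encodeInstance (R := R) hc hp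
  induction k generalizing b with
  | zero =>
    rw [greedyTree]
    -- Without fuel there is no untested variable, so the interval is a single position and has no
    -- edge.
    refine (gainOne_eq_zero_iff (c := c) (p := p) b).1 ?_
    have := count_add_count b
    rw [gainOne, show n - count false b - count true b = 0 by omega]
    rfl
  | succ k ih =>
    by_cases h : gainOne (encodeInstance R c p) b = 0
    · rw [greedyTree_of_gainOne_eq_zero h]
      exact (gainOne_eq_zero_iff b).1 h
    · rw [hw.greedyTree_succ h]
      obtain ⟨hlt, hflag, hbest⟩ := hw.searchBest_spec h
      have hi := testedFlag_eq_zero_iff (j := ⟨_, hlt⟩).1 hflag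
      have hcard : ∀ l, (Finset.univ.filter fun i => setBit b ⟨_, hlt⟩ l i = none).card ≤ k := by
        intro l
        have e1 := count_add_count b
        have e2 := count_add_count (setBit b ⟨_, hlt⟩ l)
        cases l <;>
          rw [count_setBit_self hi, count_setBit_ne hi (by decide)] at e2 <;> omega
      refine ⟨fun hg => h ((gainOne_eq_zero_iff b).2 hg), hi, fun j hj => ?_, ih (hcard _),
        ih (hcard _)⟩
      rw [expectedGain_div_cost hc hp hj, expectedGain_div_cost hc hp hi]
      have hle := le_scanBest (flag := testedFlag b) (num := ratioNum (encodeInstance R c p) n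
        (gainOne (encodeInstance R c p) b) (gainZero (encodeInstance R c p) b))
        hw.ratioDen_pos j.2 (testedFlag_eq_zero_iff.2 hj)
      change _ * (searchBest (encodeInstance R c p) b n).2.2 ≤
        (searchBest (encodeInstance R c p) b n).2.1 * _ at hle
      rw [hbest] at hle
      rw [div_le_div_iff₀ (by exact_mod_cast hw.ratioDen_pos j j.2)
        (by exact_mod_cast hw.ratioDen_pos _ hlt)]
      exact_mod_cast hle

/-- At the goal `f` is constant on the extensions of `b`, and setting all untested bits to zero
gives one with exactly `count true b` ones. -/
theorem decide_value_eq {f : (Fin n → Bool) → Bool} (hf : IsSymmetric f)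
    {b : PartialAssignment n} (hg : goalFunction (valueVector f) b = goalValue (valueVector f))
    {x : Fin n → Bool} (hx : Extends (fun i => some (x i)) b) :
    decide ((encodeInstance (valueVector f) c p).getD (1 + count true b) 0 = 1) = f x := by
  obtain ⟨a, ha, hab⟩ := exists_extends_numOnes b (j := count true b) le_rfl
    (by have := count_add_count_le b; omega)
  have hlt : count true b < n + 1 := by have := count_add_count_le b; omega
  rw [((goalFunction_isGoalFunction hf).eq_goal_iff b).1 hg x a hx ha,
    hf.eq_valueVector a ⟨_, hlt⟩ hab, encodeInstance_value _ c p ⟨_, hlt⟩]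
  cases valueVector f ⟨_, hlt⟩ <;> rfl

/-- A leaf of a greedy run has utility `Q`, whichever clause of `greedyTree` produced it, so its
label is right. -/
theorem IsAdaptiveGreedyFrom.eval_greedyTree {f : (Fin n → Bool) → Bool} (hf : IsSymmetric f)
    (k : ℕ) {b : PartialAssignment n} {c' p' : Fin n → ℝ}
    (h : IsAdaptiveGreedyFrom (goalFunction (valueVector f)) (goalValue (valueVector f)) c' p'
      b (greedyTree (encodeInstance (valueVector f) c p) k b)) {x : Fin n → Bool}
    (hx : Extends (fun i => some (x i)) b) :
    (greedyTree (encodeInstance (valueVector f) c p) k b).eval x = f x := by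
  induction k generalizing b with
  | zero => exact decide_value_eq hf h hx
  | succ k ih =>
    rw [greedyTree] at h ⊢
    split_ifs at h ⊢ with h1 h2
    · exact decide_value_eq hf h hx
    · obtain ⟨-, hi, -, hlo, hhi⟩ := h
      have hxb : Extends (fun i => some (x i)) (setBit b ⟨_, h2⟩ (x ⟨_, h2⟩)) := by
        intro j hj
        by_cases hji : j = ⟨_, h2⟩
        · subst hji; simp
        · rw [setBit_of_ne hji] at hj ⊢
          exact hx j hj
      rw [DecisionTree.eval]
      split
      · next hxi => rw [hxi] at hxb; exact ih hhi hxb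
      · next hxi => rw [Bool.not_eq_true] at hxi; rw [hxi] at hxb; exact ih hlo hxb
    · exact decide_value_eq hf h hx

end Encoding
-- Bounds on bit lengths and time read off from the syntax
section Bounds

theorem size_add_le (a b : ℕ) : Nat.size (a + b) ≤ max (Nat.size a) (Nat.size b) + 1 := by
  rw [Nat.size_le, pow_succ, mul_two]
  exact add_lt_add
    ((Nat.lt_size_self a).trans_le (Nat.pow_le_pow_right two_pos (le_max_left _ _)))
    ((Nat.lt_size_self b).trans_le (Nat.pow_le_pow_right two_pos (le_max_right _ _)))

theorem size_mul_le (a b : ℕ) : Nat.size (a * b) ≤ Nat.size a + Nat.size b := by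
  rw [Nat.size_le, pow_add]
  exact Nat.mul_lt_mul'' (Nat.lt_size_self a) (Nat.lt_size_self b)

theorem size_le_self (a : ℕ) : Nat.size a ≤ a := Nat.size_le.2 Nat.lt_two_pow_self

/-- A bound for the bit lengths of the memory contents of `greedyProgram`, in terms of the bit
length of the input. -/
noncomputable def cellBound : Polynomial ℕ := 8 * Polynomial.X + 8

/-- A bound for the bit length of the value of an expression. -/
noncomputable def Expr.sizeBound : Expr → Polynomial ℕ
  | lit k => Polynomial.C (Nat.size k)
  | input _ => Polynomial.X
  | cell _ => cellBound
  | add e₁ e₂ => e₁.sizeBound + e₂.sizeBound + 1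
  | sub e₁ _ => e₁.sizeBound
  | mul e₁ e₂ => e₁.sizeBound + e₂.sizeBound

/-- A bound for the time for evaluating an expression. -/
noncomputable def Expr.timeBound : Expr → Polynomial ℕ
  | lit k => Polynomial.C (Nat.size k) + 1
  | input e => e.timeBound + (input e).sizeBound + 1
  | cell e => e.timeBound + (cell e).sizeBound + 1
  | add e₁ e₂ => e₁.timeBound + e₂.timeBound + (add e₁ e₂).sizeBound + 1
  | sub e₁ e₂ => e₁.timeBound + e₂.timeBound + (sub e₁ e₂).sizeBound + 1
  | mul e₁ e₂ => e₁.timeBound + e₂.timeBound + (mul e₁ e₂).sizeBound + 1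

/-- A bound for the running time of a program every loop of which is iterated at most as often as
the bit length of the input. -/
noncomputable def Program.timeBound : Program → Polynomial ℕ
  | skip => 1
  | assign a e => a.timeBound + e.timeBound + 1
  | test a e => a.timeBound + e.timeBound + 1
  | seq P₁ P₂ => P₁.timeBound + P₂.timeBound + 1
  | cond e P₁ P₂ => e.timeBound + P₁.timeBound + P₂.timeBound + 1
  | loop e P => (Polynomial.X + 1) * (e.timeBound + P.timeBound + 1)

theorem size_getD_le (w : List ℕ) (k : ℕ) : Nat.size (w.getD k 0) ≤ inputSize w := by
  rcases Nat.lt_or_ge k w.length with h | h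
  · rw [List.getD_eq_getElem _ _ h]
    have := List.single_le_sum (l := w.map fun k => Nat.size k + 1) (fun _ _ => Nat.zero_le _)
      (Nat.size w[k] + 1) (List.mem_map.2 ⟨_, List.getElem_mem h, rfl⟩)
    unfold inputSize
    omega
  · rw [List.getD_eq_default _ _ h]
    simp

theorem length_le_inputSize (w : List ℕ) : w.length ≤ inputSize w := by
  induction w with
  | nil => simp
  | cons a w ih =>
    simp only [inputSize, List.length_cons, List.map_cons, List.sum_cons] at ih ⊢
    omega

/-- The bit lengths of the memory contents are bounded in terms of the bit length of the input. -/
def IsBounded (w : List ℕ) (m : Memory) : Prop :=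
  ∀ a, Nat.size (m a) ≤ cellBound.eval (inputSize w)

theorem IsBounded.update {w : List ℕ} {m : Memory} (h : IsBounded w m) (a : ℕ) {v : ℕ}
    (hv : Nat.size v ≤ cellBound.eval (inputSize w)) : IsBounded w (Function.update m a v) := by
  intro a'
  by_cases ha : a' = a
  · subst ha; simpa using hv
  · simpa [ha] using h a'

theorem IsBounded.size_eval_le {w : List ℕ} {m : Memory} (h : IsBounded w m) (e : Expr) :
    Nat.size (e.eval w m) ≤ e.sizeBound.eval (inputSize w) := by
  induction e with
  | lit k => simp [Expr.eval, Expr.sizeBound]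
  | input e ih => simpa [Expr.eval, Expr.sizeBound] using size_getD_le w _
  | cell e ih => exact h _
  | add e₁ e₂ ih₁ ih₂ =>
    have := size_add_le (e₁.eval w m) (e₂.eval w m)
    simp only [Expr.eval, Expr.sizeBound, Polynomial.eval_add, Polynomial.eval_one]
    omega
  | sub e₁ e₂ ih₁ ih₂ => exact (Nat.size_le_size (Nat.sub_le _ _)).trans ih₁
  | mul e₁ e₂ ih₁ ih₂ =>
    have := size_mul_le (e₁.eval w m) (e₂.eval w m)
    simp only [Expr.eval, Expr.sizeBound, Polynomial.eval_add]
    omega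

theorem IsBounded.time_le {w : List ℕ} {m : Memory} (h : IsBounded w m) (e : Expr) :
    e.time w m ≤ e.timeBound.eval (inputSize w) := by
  induction e with
  | lit k => simp [Expr.time, Expr.timeBound]
  | input e ih =>
    have := h.size_eval_le (.input e)
    simp only [Expr.time, Expr.timeBound, Polynomial.eval_add, Polynomial.eval_one]
    omega
  | cell e ih =>
    have := h.size_eval_le (.cell e)
    simp only [Expr.time, Expr.timeBound, Polynomial.eval_add, Polynomial.eval_one]
    omega
  | add e₁ e₂ ih₁ ih₂ =>
    have := h.size_eval_le (.add e₁ e₂)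
    simp only [Expr.time, Expr.timeBound, Polynomial.eval_add, Polynomial.eval_one]
    omega
  | sub e₁ e₂ ih₁ ih₂ =>
    have := h.size_eval_le (.sub e₁ e₂)
    simp only [Expr.time, Expr.timeBound, Polynomial.eval_add, Polynomial.eval_one]
    omega
  | mul e₁ e₂ ih₁ ih₂ =>
    have := h.size_eval_le (.mul e₁ e₂)
    simp only [Expr.time, Expr.timeBound, Polynomial.eval_add, Polynomial.eval_one]
    omega

end Bounds

/-! ### Rules for timed program execution -/

section Runs

/-- Started in the memory `m`, the program performs the tests `L` and halts within its time bound
in a memory that satisfies `Post`. -/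
def Runs (w : List ℕ) (x : Fin n → Bool) (P : Program) (m : Memory) (L : List (Fin n))
    (Post : Memory → Prop) : Prop :=
  ∃ t m', Exec w x P m L t m' ∧ t ≤ P.timeBound.eval (inputSize w) ∧ Post m'

variable {w : List ℕ} {x : Fin n → Bool} {m : Memory} {Post : Memory → Prop}

theorem Runs.skip (h : Post m) : Runs w x .skip m [] Post :=
  ⟨_, _, .skip m, by simp [Program.timeBound], h⟩

theorem Runs.assign {a e : Expr} (hm : IsBounded w m)
    (h : Post (Function.update m (a.eval w m) (e.eval w m))) :
    Runs w x (.assign a e) m [] Post := by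
  refine ⟨_, _, .assign a e m, ?_, h⟩
  have := hm.time_le a
  have := hm.time_le e
  simp only [Program.timeBound, Polynomial.eval_add, Polynomial.eval_one]
  omega

theorem Runs.test {a e : Expr} (hm : IsBounded w m) {i : Fin n} (he : e.eval w m = i)
    (h : Post (Function.update m (a.eval w m) (x i).toNat)) :
    Runs w x (.test a e) m [i] Post := by
  have hlt : e.eval w m < n := by omega
  obtain rfl : (⟨e.eval w m, hlt⟩ : Fin n) = i := Fin.ext he
  refine ⟨_, _, .test a e m hlt, ?_, h⟩
  have := hm.time_le a
  have := hm.time_le e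
  simp only [Program.timeBound, Polynomial.eval_add, Polynomial.eval_one]
  omega

/-- The postcondition of the first program is that the second one runs as wanted, so a correctness
proof can follow the program text without naming the intermediate memories. -/
theorem Runs.seq {P₁ P₂ : Program} {L₁ L₂ : List (Fin n)}
    (h : Runs w x P₁ m L₁ fun m' => Runs w x P₂ m' L₂ Post) :
    Runs w x (.seq P₁ P₂) m (L₁ ++ L₂) Post := by
  obtain ⟨t₁, m₁, h₁, ht₁, t₂, m₂, h₂, ht₂, h⟩ := h
  refine ⟨_, _, .seq h₁ h₂, ?_, h⟩
  simp only [Program.timeBound, Polynomial.eval_add, Polynomial.eval_one]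
  omega

theorem Runs.seq_of_nil {P₁ P₂ : Program} {L : List (Fin n)}
    (h : Runs w x P₁ m [] fun m' => Runs w x P₂ m' L Post) :
    Runs w x (.seq P₁ P₂) m L Post :=
  Runs.seq h

theorem Runs.assign_seq {a e : Expr} {P : Program} {L : List (Fin n)} (hm : IsBounded w m)
    (h : Runs w x P (Function.update m (a.eval w m) (e.eval w m)) L Post) :
    Runs w x (.seq (.assign a e) P) m L Post :=
  Runs.seq_of_nil (Runs.assign hm h)

theorem Runs.cond {e : Expr} {P₁ P₂ : Program} {L : List (Fin n)} (hm : IsBounded w m)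
    (h₁ : e.eval w m ≠ 0 → Runs w x P₁ m L Post) (h₂ : e.eval w m = 0 → Runs w x P₂ m L Post) :
    Runs w x (.cond e P₁ P₂) m L Post := by
  have := hm.time_le e
  by_cases he : e.eval w m = 0
  · obtain ⟨t, m', h, ht, hp⟩ := h₂ he
    refine ⟨_, _, .cond_false he h, ?_, hp⟩
    simp only [Program.timeBound, Polynomial.eval_add, Polynomial.eval_one]
    omega
  · obtain ⟨t, m', h, ht, hp⟩ := h₁ he
    refine ⟨_, _, .cond_true he h, ?_, hp⟩
    simp only [Program.timeBound, Polynomial.eval_add, Polynomial.eval_one]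
    omega

theorem Runs.mono {P : Program} {L : List (Fin n)} {Post' : Memory → Prop}
    (h : Runs w x P m L Post) (hp : ∀ m', Post m' → Post' m') : Runs w x P m L Post' := by
  obtain ⟨t, m', h, ht, h'⟩ := h
  exact ⟨t, m', h, ht, hp m' h'⟩

/-- The invariant `I` of a loop depends on the number of remaining iterations and the remaining
tests. -/
theorem Runs.loop {e : Expr} {P : Program} {I : ℕ → List (Fin n) → Memory → Prop}
    (hbdd : ∀ k L m, I k L m → IsBounded w m)
    (hstep : ∀ k L m, I (k + 1) L m → e.eval w m ≠ 0 ∧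
      ∃ L₁ L₂, L = L₁ ++ L₂ ∧ Runs w x P m L₁ (I k L₂))
    (hend : ∀ L m, I 0 L m → e.eval w m = 0 ∧ L = [] ∧ Post m) {k : ℕ}
    (hk : k ≤ inputSize w) {L : List (Fin n)} (h : I k L m) :
    Runs w x (.loop e P) m L Post := by
  -- There are `k` passes and one last evaluation of the guard, whence `k + 1`; the bound `k ≤
  -- inputSize w` enters only at the end.
  suffices H : ∃ t m', Exec w x (.loop e P) m L t m' ∧ t ≤ (k + 1) *
      (e.timeBound.eval (inputSize w) + P.timeBound.eval (inputSize w) + 1) ∧ Post m' by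
    obtain ⟨t, m', h1, h2, h3⟩ := H
    refine ⟨t, m', h1, h2.trans ?_, h3⟩
    simp only [Program.timeBound, Polynomial.eval_mul, Polynomial.eval_add, Polynomial.eval_one,
      Polynomial.eval_X]
    gcongr
  clear hk
  induction k generalizing m L with
  | zero =>
    obtain ⟨he, rfl, hp⟩ := hend _ _ h
    refine ⟨_, _, .loop_done he, ?_, hp⟩
    have := (hbdd _ _ _ h).time_le e
    omega
  | succ k ih =>
    obtain ⟨he, L₁, L₂, rfl, t₁, m₁, h₁, ht₁, hI⟩ := hstep _ _ _ h
    obtain ⟨t₂, m₂, h₂, ht₂, hp⟩ := ih hI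
    refine ⟨_, _, .loop_step he h₁ h₂, ?_, hp⟩
    have := (hbdd _ _ _ h).time_le e
    rw [add_mul _ 1, one_mul]
    omega

/-- A loop without tests that is iterated `N` times. -/
theorem Runs.forLoop {e : Expr} {P : Program} (J : ℕ → Memory → Prop) {N : ℕ}
    (hN : N ≤ inputSize w) (hJ : ∀ k m, J k m → IsBounded w m ∧ e.eval w m = N - k)
    (hstep : ∀ k m, k < N → J k m → Runs w x P m [] (J (k + 1))) (h : J 0 m)
    (hend : ∀ m, J N m → Post m) : Runs w x (.loop e P) m [] Post := by
  refine Runs.loop (I := fun k L m => L = [] ∧ k ≤ N ∧ J (N - k) m)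
    (fun k L m h => (hJ _ _ h.2.2).1) ?_ ?_ hN (L := []) ⟨rfl, le_rfl, by simpa using h⟩
  · rintro k L m ⟨rfl, hk, h⟩
    refine ⟨by rw [(hJ _ _ h).2]; omega, [], [], rfl, ?_⟩
    refine (hstep _ _ (by omega) h).mono fun m' hm' => ⟨rfl, by omega, ?_⟩
    rwa [show N - (k + 1) + 1 = N - k by omega] at hm'
  · rintro L m ⟨rfl, hk, h⟩
    exact ⟨by rw [(hJ _ _ h).2]; omega, rfl, hend _ (by simpa using h)⟩

end Runs
-- The program and its correctness
section GreedyProgram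

/-- The content of register `a`. -/
def reg (a : ℕ) : Expr := .cell (.lit a)

/-- The number of variables. -/
def varCount : Expr := .input (.lit 0)

/-- The entry of the value vector at position `e`. -/
def valueAt (e : Expr) : Expr := .input (.add (.lit 1) e)

/-- The distance of two natural numbers. -/
def distExpr (e₁ e₂ : Expr) : Expr := .add (.sub e₁ e₂) (.sub e₂ e₁)

/-- The entry for variable `e` of the parameter list that starts at position `off`. -/
def paramAt (off e : Expr) : Expr := .input (.add (.add off (.lit 2)) e)

def costNumAt (e : Expr) : Expr := paramAt varCount e

def costDenAt (e : Expr) : Expr := paramAt (.add varCount varCount) e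

def probNumAt (e : Expr) : Expr := paramAt (.add (.add varCount varCount) varCount) e

def probDenAt (e : Expr) : Expr :=
  paramAt (.add (.add (.add varCount varCount) varCount) varCount) e

/-- `ratioNum` of the variable in register `3`. -/
def ratioNumExpr : Expr :=
  .mul (.add (.mul (probNumAt (reg 3)) (reg 4))
    (.mul (.sub (probDenAt (reg 3)) (probNumAt (reg 3))) (reg 5))) (costDenAt (reg 3))

/-- `ratioDen` of the variable in register `3`. -/
def ratioDenExpr : Expr := .mul (probDenAt (reg 3)) (costNumAt (reg 3))

/-- Adds one to register `a`. -/
def increment (a : ℕ) : Program := .assign (.lit a) (.add (reg a) (.lit 1))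

/-- Computes `scanUp` into register `4`. -/
def scanUpProgram : Program :=
  .seq (.assign (.lit 4) (.lit 0)) (.seq (.assign (.lit 3) (.lit 0))
    (.loop (.sub (.sub (reg 2) (reg 1)) (reg 3))
      (.seq (.cond (.add (reg 4) (distExpr
          (valueAt (.add (reg 1) (.add (reg 3) (.lit 1)))) (valueAt (reg 1))))
        (increment 4) .skip) (increment 3))))

/-- Computes `scanDown` into register `5`. -/
def scanDownProgram : Program :=
  .seq (.assign (.lit 5) (.lit 0)) (.seq (.assign (.lit 3) (.lit 0))
    (.loop (.sub (.sub (reg 2) (reg 1)) (reg 3))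
      (.seq (.cond (.add (reg 5) (distExpr
          (valueAt (.sub (reg 2) (.add (reg 3) (.lit 1)))) (valueAt (reg 2))))
        (increment 5) .skip) (increment 3))))

/-- Computes `searchBest` into the registers `6`, `7` and `8`. -/
def searchProgram : Program :=
  .seq (.assign (.lit 6) (.lit 0)) (.seq (.assign (.lit 7) (.lit 0))
    (.seq (.assign (.lit 8) (.lit 1)) (.seq (.assign (.lit 3) (.lit 0))
      (.loop (.sub varCount (reg 3))
        (.seq (.cond (.cell (.add (.lit 16) (reg 3))) .skip
          (.cond (.sub (.mul ratioNumExpr (reg 8)) (.mul (reg 7) ratioDenExpr))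
            (.seq (.assign (.lit 6) (reg 3)) (.seq (.assign (.lit 7) ratioNumExpr)
              (.assign (.lit 8) ratioDenExpr))) .skip)) (increment 3))))))

/-- Tests the variable in register `6` and records the outcome. -/
def testProgram : Program :=
  .seq (.test (.lit 10) (reg 6)) (.seq (.assign (.add (.lit 16) (reg 6)) (.lit 1))
    (.cond (reg 10) (increment 1) (.assign (.lit 2) (.sub (reg 2) (.lit 1)))))

/-- One step of Adaptive Greedy. -/
def stepProgram : Program :=
  .seq (.seq scanUpProgram (.seq scanDownProgram
    (.cond (reg 4) (.seq searchProgram testProgram) .skip))) (increment 9)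

/-- Adaptive Greedy for a symmetric function. The registers `1` and `2` delimit the part of
the value vector that is left, and cell `16 + j` tells whether variable `j` is tested. -/
def greedyProgram : Program :=
  .seq (.assign (.lit 2) varCount)
    (.seq (.loop (.sub varCount (reg 9)) stepProgram) (.assign (.lit 0) (valueAt (reg 1))))

/-- The memory `m` represents the state `b`, after `k` steps. -/
structure Represents (w : List ℕ) (b : PartialAssignment n) (k : ℕ) (m : Memory) : Prop where
  bounded : IsBounded w m
  lower : m 1 = count true b
  upper : m 2 = n - count false b
  counter : m 9 = k
  flags : ∀ j < n, m (16 + j) = testedFlag b j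

variable {w : List ℕ} {b : PartialAssignment n} {c : ℕ} {m : Memory}

/-- The registers below 16 other than 1, 2 and 9 are scratch space. -/
theorem Represents.update (h : Represents w b c m) (a : ℕ) {v : ℕ}
    (ha : a < 16 ∧ a ≠ 1 ∧ a ≠ 2 ∧ a ≠ 9)
    (hv : Nat.size v ≤ cellBound.eval (inputSize w)) :
    Represents w b c (Function.update m a v) where
  bounded := h.bounded.update a hv
  lower := by rw [Function.update_of_ne ha.2.1.symm, h.lower]
  upper := by rw [Function.update_of_ne ha.2.2.1.symm, h.upper]
  counter := by rw [Function.update_of_ne ha.2.2.2.symm, h.counter]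
  flags j hj := by rw [Function.update_of_ne (by omega), h.flags j hj]

theorem eval_cellBound (S : ℕ) : cellBound.eval S = 8 * S + 8 := by
  simp [cellBound]

theorem size_le_cellBound {v : ℕ} (hv : v ≤ inputSize w + 1) :
    Nat.size v ≤ cellBound.eval (inputSize w) := by
  have := size_le_self v
  rw [eval_cellBound]
  omega

theorem ValidInput.le_inputSize (hw : ValidInput n w) : n ≤ inputSize w := by
  rcases Nat.eq_zero_or_pos n with rfl | hn
  · exact Nat.zero_le _
  -- A positive entry is not the default value 0, so the list extends beyond that position.
  have := hw.probDen_pos 0 hn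
  have hlt : n < w.length := by
    by_contra! h
    rw [List.getD_eq_default _ _ (by omega)] at this
    omega
  exact hlt.le.trans (length_le_inputSize w)

theorem size_ratioNum_le {u d j : ℕ} (hu : u ≤ inputSize w) (hd : d ≤ inputSize w) :
    Nat.size (ratioNum w n u d j) ≤ cellBound.eval (inputSize w) := by
  unfold ratioNum
  generalize n + n + n + 2 + j = i₁
  generalize n + n + n + n + 2 + j = i₂
  generalize n + n + 2 + j = i₃
  have h1 := size_getD_le w i₁
  have h2 := size_getD_le w i₂
  have h3 := size_getD_le w i₃
  have h4 := (size_le_self u).trans hu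
  have h5 := (size_le_self d).trans hd
  have h6 := Nat.size_le_size (Nat.sub_le (w.getD i₂ 0) (w.getD i₁ 0))
  have h7 := size_mul_le (w.getD i₁ 0) u
  have h8 := size_mul_le (w.getD i₂ 0 - w.getD i₁ 0) d
  have h9 := size_add_le (w.getD i₁ 0 * u) ((w.getD i₂ 0 - w.getD i₁ 0) * d)
  have h10 := size_mul_le (w.getD i₁ 0 * u + (w.getD i₂ 0 - w.getD i₁ 0) * d) (w.getD i₃ 0)
  rw [eval_cellBound]
  omega

theorem size_ratioDen_le {j : ℕ} :
    Nat.size (ratioDen w n j) ≤ cellBound.eval (inputSize w) := by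
  unfold ratioDen
  have h1 := size_getD_le w (n + n + n + n + 2 + j)
  have h2 := size_getD_le w (n + 2 + j)
  have h3 := size_mul_le (w.getD (n + n + n + n + 2 + j) 0) (w.getD (n + 2 + j) 0)
  rw [eval_cellBound]
  omega

theorem eval_ratioNumExpr (hw : ValidInput n w) :
    ratioNumExpr.eval w m = ratioNum w n (m 4) (m 5) (m 3) := by
  simp only [ratioNumExpr, ratioNum, probNumAt, probDenAt, costDenAt, paramAt, varCount, reg,
    Expr.eval, hw.size_eq]

theorem eval_ratioDenExpr (hw : ValidInput n w) :
    ratioDenExpr.eval w m = ratioDen w n (m 3) := by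
  simp only [ratioDenExpr, ratioDen, probDenAt, costNumAt, paramAt, varCount, reg, Expr.eval,
    hw.size_eq]

variable {x : Fin n → Bool}

theorem runs_scanUpProgram (hw : ValidInput n w) (h : Represents w b c m) :
    Runs w x scanUpProgram m [] fun m' => Represents w b c m' ∧ m' 4 = gainOne w b := by
  have hn := hw.le_inputSize
  refine Runs.assign_seq h.bounded ?_
  have h := h.update 4 (v := 0) (by decide) (by simp)
  refine Runs.assign_seq h.bounded ?_
  have h := h.update 3 (v := 0) (by decide) (by simp)
  refine Runs.forLoop (N := n - count false b - count true b)
    (fun k m => Represents w b c m ∧ m 3 = k ∧ m 4 = scanUp w (count true b) k)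
    (by omega) ?_ ?_ ?_ ?_
  · rintro k m ⟨hm, h3, h4⟩
    exact ⟨hm.bounded, by simp [Expr.eval, reg, hm.lower, hm.upper, h3]⟩
  · rintro k m hk ⟨hm, h3, h4⟩
    have hle := scanUp_le w (count true b) k
    have hinc : ∀ m, Represents w b c m → m 3 = k → m 4 = scanUp w (count true b) (k + 1) →
        Runs w x (increment 3) m [] fun m' => Represents w b c m' ∧ m' 3 = k + 1 ∧
          m' 4 = scanUp w (count true b) (k + 1) := by
      intro m hm h3 h4
      refine Runs.assign hm.bounded ?_
      simp only [Expr.eval, reg, h3]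
      exact ⟨hm.update 3 (by decide) (size_le_cellBound (by omega)), by simp, by simp [h4]⟩
    refine Runs.seq_of_nil (Runs.cond hm.bounded (fun he => ?_) fun he => ?_)
    · refine Runs.assign hm.bounded ?_
      simp only [Expr.eval, reg, distExpr, valueAt, hm.lower, h3, h4] at he ⊢
      refine hinc _ (hm.update 4 (by decide) (size_le_cellBound (by omega))) (by simp [h3]) ?_
      rw [scanUp, if_pos he, Function.update_self]
    · simp only [Expr.eval, reg, distExpr, valueAt, hm.lower, h3, h4] at he
      refine Runs.skip (hinc _ hm h3 ?_)
      rw [scanUp, if_neg (not_not.2 he), h4]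
  · exact ⟨h, by simp [Expr.eval], by simp [Expr.eval, scanUp]⟩
  · rintro m ⟨hm, -, h4⟩
    exact ⟨hm, h4⟩

theorem runs_scanDownProgram (hw : ValidInput n w) (h : Represents w b c m) {u : ℕ}
    (hu : m 4 = u) :
    Runs w x scanDownProgram m [] fun m' =>
      Represents w b c m' ∧ m' 4 = u ∧ m' 5 = gainZero w b := by
  have hn := hw.le_inputSize
  refine Runs.assign_seq h.bounded ?_
  have h := h.update 5 (v := 0) (by decide) (by simp)
  refine Runs.assign_seq h.bounded ?_
  have h := h.update 3 (v := 0) (by decide) (by simp)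
  refine Runs.forLoop (N := n - count false b - count true b)
    (fun k m => Represents w b c m ∧ m 4 = u ∧ m 3 = k ∧
      m 5 = scanDown w (n - count false b) k) (by omega) ?_ ?_ ?_ ?_
  · rintro k m ⟨hm, -, h3, -⟩
    exact ⟨hm.bounded, by simp [Expr.eval, reg, hm.lower, hm.upper, h3]⟩
  · rintro k m hk ⟨hm, h4, h3, h5⟩
    have hle := scanDown_le w (n - count false b) k
    have hinc : ∀ m, Represents w b c m → m 4 = u → m 3 = k →
        m 5 = scanDown w (n - count false b) (k + 1) →
        Runs w x (increment 3) m [] fun m' => Represents w b c m' ∧ m' 4 = u ∧ m' 3 = k + 1 ∧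
          m' 5 = scanDown w (n - count false b) (k + 1) := by
      intro m hm h4 h3 h5
      refine Runs.assign hm.bounded ?_
      simp only [Expr.eval, reg, h3]
      exact ⟨hm.update 3 (by decide) (size_le_cellBound (by omega)), by simp [h4], by simp,
        by simp [h5]⟩
    refine Runs.seq_of_nil (Runs.cond hm.bounded (fun he => ?_) fun he => ?_)
    · refine Runs.assign hm.bounded ?_
      simp only [Expr.eval, reg, distExpr, valueAt, hm.upper, h3, h5] at he ⊢
      refine hinc _ (hm.update 5 (by decide) (size_le_cellBound (by omega))) (by simp [h4])
        (by simp [h3]) ?_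
      rw [scanDown, if_pos he, Function.update_self]
    · simp only [Expr.eval, reg, distExpr, valueAt, hm.upper, h3, h5] at he
      refine Runs.skip (hinc _ hm h4 h3 ?_)
      rw [scanDown, if_neg (not_not.2 he), h5]
  · exact ⟨h, by simp [Expr.eval, hu], by simp [Expr.eval], by simp [Expr.eval, scanDown]⟩
  · rintro m ⟨hm, h4, -, h5⟩
    exact ⟨hm, h4, h5⟩

theorem runs_searchProgram (hw : ValidInput n w) (h : Represents w b c m)
    (h4 : m 4 = gainOne w b) (h5 : m 5 = gainZero w b) :
    Runs w x searchProgram m [] fun m' =>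
      Represents w b c m' ∧ m' 6 = (searchBest w b n).1 := by
  have hn := hw.le_inputSize
  have hone : gainOne w b ≤ inputSize w :=
    (scanUp_le w (count true b) (n - count false b - count true b)).trans (by omega)
  have hzero : gainZero w b ≤ inputSize w :=
    (scanDown_le w (n - count false b) (n - count false b - count true b)).trans (by omega)
  refine Runs.assign_seq h.bounded ?_
  have h := h.update 6 (v := 0) (by decide) (by simp)
  refine Runs.assign_seq h.bounded ?_
  have h := h.update 7 (v := 0) (by decide) (by simp)
  refine Runs.assign_seq h.bounded ?_
  have h := h.update 8 (v := 1) (by decide) (size_le_cellBound (by omega))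
  refine Runs.assign_seq h.bounded ?_
  have h := h.update 3 (v := 0) (by decide) (by simp)
  refine Runs.forLoop (N := n)
    (fun k m => Represents w b c m ∧ m 3 = k ∧ m 4 = gainOne w b ∧ m 5 = gainZero w b ∧
      (m 6, m 7, m 8) = searchBest w b k) hn ?_ ?_ ?_ ?_
  · rintro k m ⟨hm, h3, -⟩
    exact ⟨hm.bounded, by simp only [Expr.eval, reg, varCount, h3, hw.size_eq]⟩
  · rintro k m hk ⟨hm, h3, h4, h5, hbest⟩
    have hinc : ∀ m, Represents w b c m → m 3 = k → m 4 = gainOne w b → m 5 = gainZero w b →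
        (m 6, m 7, m 8) = searchBest w b (k + 1) →
        Runs w x (increment 3) m [] fun m' => Represents w b c m' ∧ m' 3 = k + 1 ∧
          m' 4 = gainOne w b ∧ m' 5 = gainZero w b ∧
          (m' 6, m' 7, m' 8) = searchBest w b (k + 1) := by
      intro m hm h3 h4 h5 hbest
      refine Runs.assign hm.bounded ?_
      simp only [Expr.eval, reg, h3]
      exact ⟨hm.update 3 (by decide) (size_le_cellBound (by omega)), by simp, by simp [h4],
        by simp [h5], by simpa using hbest⟩
    have hnum : ratioNumExpr.eval w m = ratioNum w n (gainOne w b) (gainZero w b) k := by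
      rw [eval_ratioNumExpr hw, h3, h4, h5]
    have hden : ratioDenExpr.eval w m = ratioDen w n k := by rw [eval_ratioDenExpr hw, h3]
    have hstep : searchBest w b (k + 1) = if testedFlag b k ≠ 0 then (m 6, m 7, m 8)
        else if ratioNum w n (gainOne w b) (gainZero w b) k * m 8 - m 7 * ratioDen w n k ≠ 0
        then (k, ratioNum w n (gainOne w b) (gainZero w b) k, ratioDen w n k)
        else (m 6, m 7, m 8) := by
      have h8 : m 8 = (searchBest w b k).2.2 := by rw [← hbest]
      have h7 : m 7 = (searchBest w b k).2.1 := by rw [← hbest]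
      rw [hbest, h7, h8]
      rfl
    refine Runs.seq_of_nil (Runs.cond hm.bounded (fun he => ?_) fun he => ?_)
    · simp only [Expr.eval, reg, h3, hm.flags k hk] at he
      refine Runs.skip (hinc _ hm h3 h4 h5 ?_)
      rw [hstep, if_pos he]
    · simp only [Expr.eval, reg, h3, hm.flags k hk] at he
      rw [if_neg (not_not.2 he)] at hstep
      refine Runs.cond hm.bounded (fun he' => ?_) fun he' => ?_
      · simp only [Expr.eval, reg, hnum, hden] at he'
        rw [if_pos he'] at hstep
        refine Runs.assign_seq hm.bounded ?_
        have hm₁ := hm.update 6 (v := k) (by decide) (size_le_cellBound (by omega))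
        simp only [Expr.eval, reg, h3]
        refine Runs.assign_seq hm₁.bounded ?_
        have hm₂ := hm₁.update 7 (v := ratioNum w n (gainOne w b) (gainZero w b) k) (by decide)
          (size_ratioNum_le hone hzero)
        rw [eval_ratioNumExpr hw]
        -- The ratio expressions read the registers 3, 4 and 5 only, so overwriting 6 and 7 does not
        -- disturb them.
        simp only [Expr.eval, Function.update_of_ne (show (4 : ℕ) ≠ 6 by decide),
          Function.update_of_ne (show (5 : ℕ) ≠ 6 by decide),
          Function.update_of_ne (show (3 : ℕ) ≠ 6 by decide), h3, h4, h5]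
        refine Runs.assign hm₂.bounded ?_
        have hm₃ := hm₂.update 8 (v := ratioDen w n k) (by decide) size_ratioDen_le
        rw [eval_ratioDenExpr hw]
        simp only [Expr.eval, Function.update_of_ne (show (3 : ℕ) ≠ 7 by decide),
          Function.update_of_ne (show (3 : ℕ) ≠ 6 by decide), h3]
        exact hinc _ hm₃ (by simp [h3]) (by simp [h4]) (by simp [h5]) (by simp [hstep])
      · simp only [Expr.eval, reg, hnum, hden] at he'
        rw [if_neg (not_not.2 he')] at hstep
        exact Runs.skip (hinc _ hm h3 h4 h5 hstep.symm)
  · exact ⟨h, by simp [Expr.eval], by simp [Expr.eval, h4], by simp [Expr.eval, h5],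
      by simp [Expr.eval, searchBest, scanBest]⟩
  · rintro m ⟨hm, -, -, -, hbest⟩
    exact ⟨hm, by rw [← hbest]⟩

theorem runs_testProgram (hw : ValidInput n w) (h : Represents w b c m) {i : Fin n}
    (hi : b i = none) (h6 : m 6 = i) :
    Runs w x testProgram m [i] (Represents w (setBit b i (x i)) c) := by
  have hn := hw.le_inputSize
  have hlt := count_add_count_lt hi
  refine Runs.seq (L₁ := [i]) (L₂ := []) (Runs.test h.bounded (i := i) h6 ?_)
  have hbit := Bool.toNat_le (x i)
  have h := h.update 10 (v := (x i).toNat) (by decide) (size_le_cellBound (by omega))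
  simp only [Expr.eval]
  refine Runs.assign_seq h.bounded ?_
  have hb := h.bounded.update (16 + i) (v := 1) (size_le_cellBound (by omega))
  simp only [Expr.eval, reg, Function.update_of_ne (show (6 : ℕ) ≠ 10 by decide), h6]
  -- The flags start at cell 16, so the final update of register 1 or 2 leaves them alone.
  have hflags : ∀ (a v : ℕ), a < 16 → ∀ j < n,
      Function.update (Function.update (Function.update m 10 (x i).toNat) (16 + (i : ℕ)) 1) a v
        (16 + j) = testedFlag (setBit b i (x i)) j := by
    intro a v ha j hj
    rw [testedFlag_setBit, Function.update_of_ne (by omega)]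
    split
    · next hji => rw [hji, Function.update_self]
    · next hji => rw [Function.update_of_ne (by omega), h.flags j hj]
  have hreg : ∀ a < 16, Function.update (Function.update m 10 (x i).toNat) (16 + (i : ℕ)) 1 a =
      Function.update m 10 (x i).toNat a := fun a ha => Function.update_of_ne (by omega) ..
  refine Runs.cond hb (fun he => ?_) fun he => ?_
  · have hx : x i = true := by
      simp only [Expr.eval, hreg 10 (by decide), Function.update_self] at he
      cases hx : x i with
      | true => rfl
      | false => simp [hx] at he
    refine Runs.assign hb ?_
    simp only [Expr.eval, reg, hreg 1 (by decide), h.lower]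
    refine ⟨hb.update _ (size_le_cellBound (by omega)), ?_, ?_, ?_, hflags _ _ (by decide)⟩
    · rw [Function.update_self, hx, count_setBit_self hi]
    · rw [Function.update_of_ne (by decide), hreg 2 (by decide), h.upper, hx,
        count_setBit_ne hi (by decide)]
    · rw [Function.update_of_ne (by decide), hreg 9 (by decide), h.counter]
  · have hx : x i = false := by
      simp only [Expr.eval, hreg 10 (by decide), Function.update_self] at he
      cases hx : x i with
      | false => rfl
      | true => simp [hx] at he
    refine Runs.assign hb ?_
    simp only [Expr.eval, hreg 2 (by decide), h.upper]
    refine ⟨hb.update _ (size_le_cellBound (by omega)), ?_, ?_, ?_, hflags _ _ (by decide)⟩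
    · rw [Function.update_of_ne (by decide), hreg 1 (by decide), h.lower, hx,
        count_setBit_ne hi (by decide)]
    · rw [Function.update_self, hx, count_setBit_self hi, Nat.sub_sub]
    · rw [Function.update_of_ne (by decide), hreg 9 (by decide), h.counter]

/-- The tests and the output of `greedyProgram` after `k` steps in the state `b`. -/
def LoopInvariant (w : List ℕ) (x : Fin n → Bool) (v : Bool) (k : ℕ) (L : List (Fin n))
    (m : Memory) : Prop :=
  ∃ b : PartialAssignment n, k ≤ n ∧ Represents w b (n - k) m ∧
    L = (greedyTree w k b).tests x ∧ v = (greedyTree w k b).eval x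

/-- If the goal is reached, the tree is the same leaf for every amount of fuel, so the step idles
and the invariant persists. Otherwise the step descends one level of the tree. -/
theorem runs_stepProgram (hw : ValidInput n w) {v : Bool} {k : ℕ} {L : List (Fin n)}
    (h : LoopInvariant w x v (k + 1) L m) :
    ∃ L₁ L₂, L = L₁ ++ L₂ ∧ Runs w x stepProgram m L₁ (LoopInvariant w x v k L₂) := by
  obtain ⟨b, hk, hm, hL, hv⟩ := h
  have hn := hw.le_inputSize
  have hinc : ∀ (b : PartialAssignment n) (m : Memory), Represents w b (n - (k + 1)) m →
      Runs w x (increment 9) m [] (Represents w b (n - k)) := by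
    intro b m hm
    refine Runs.assign hm.bounded ?_
    simp only [Expr.eval, reg, hm.counter]
    refine ⟨hm.bounded.update 9 (size_le_cellBound (by omega)), ?_, ?_, ?_, fun j hj => ?_⟩
    · rw [Function.update_of_ne (by decide), hm.lower]
    · rw [Function.update_of_ne (by decide), hm.upper]
    · rw [Function.update_self]
      omega
    · rw [Function.update_of_ne (by omega), hm.flags j hj]
  have hscan : ∀ {L₁ : List (Fin n)} {Post : Memory → Prop},
      (∀ m', Represents w b (n - (k + 1)) m' → m' 4 = gainOne w b → m' 5 = gainZero w b →
        Runs w x (.cond (reg 4) (.seq searchProgram testProgram) .skip) m' L₁ Post) →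
      Runs w x (.seq scanUpProgram (.seq scanDownProgram
        (.cond (reg 4) (.seq searchProgram testProgram) .skip))) m L₁ Post := by
    intro L₁ Post h
    refine Runs.seq_of_nil ((runs_scanUpProgram hw hm).mono fun m₁ h₁ => ?_)
    refine Runs.seq_of_nil ((runs_scanDownProgram hw h₁.1 h₁.2).mono fun m₂ h₂ => ?_)
    exact h m₂ h₂.1 h₂.2.1 h₂.2.2
  by_cases hg : gainOne w b = 0
  · refine ⟨[], [], ?_, ?_⟩
    · rw [hL, greedyTree_of_gainOne_eq_zero hg]
      rfl
    · refine Runs.seq_of_nil (hscan fun m' h' h4 h5 => ?_)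
      refine Runs.cond h'.bounded (fun he => absurd (h4.trans hg) he) fun _ => Runs.skip ?_
      refine (hinc b m' h').mono fun m'' h'' => ⟨b, by omega, h'', ?_, ?_⟩
      · rw [greedyTree_of_gainOne_eq_zero hg]
        rfl
      · rw [hv, greedyTree_of_gainOne_eq_zero hg, greedyTree_of_gainOne_eq_zero hg]
  · obtain ⟨hlt, hflag, -⟩ := hw.searchBest_spec hg
    have hi := testedFlag_eq_zero_iff (j := ⟨_, hlt⟩).1 hflag
    set i : Fin n := ⟨_, hlt⟩ with hidef
    have htree : (greedyTree w (k + 1) b).tests x =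
          i :: (greedyTree w k (setBit b i (x i))).tests x ∧
        (greedyTree w (k + 1) b).eval x = (greedyTree w k (setBit b i (x i))).eval x := by
      rw [hw.greedyTree_succ hg, DecisionTree.tests, DecisionTree.eval]
      cases hx : x i <;> simp [hidef] at hx <;> simp [hidef]
    refine ⟨[i], (greedyTree w k (setBit b i (x i))).tests x, by rw [hL, htree.1]; rfl, ?_⟩
    refine Runs.seq (L₁ := [i]) (L₂ := []) (hscan fun m₁ h₁ h4 h5 => ?_)
    refine Runs.cond h₁.bounded (fun _ => ?_) fun he => absurd (h4.symm.trans he) hg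
    refine Runs.seq_of_nil ((runs_searchProgram hw h₁ h4 h5).mono fun m₂ h₂ => ?_)
    refine (runs_testProgram hw h₂.1 hi h₂.2).mono fun m₃ h₃ => ?_
    exact (hinc _ _ h₃).mono fun m₄ h₄ => ⟨_, by omega, h₄, rfl, by rw [hv, htree.2]⟩

theorem implements_greedyProgram (hw : ValidInput n w) :
    Implements greedyProgram w (greedyTree w n fun _ : Fin n => none)
      (greedyProgram.timeBound.eval (inputSize w)) := by
  intro x
  have hn := hw.le_inputSize
  set T := greedyTree w n fun _ : Fin n => none with hT
  suffices H : Runs w x greedyProgram (fun _ => 0) (T.tests x)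
      fun m => m 0 = (T.eval x).toNat by
    obtain ⟨t, m, h1, h2, h3⟩ := H
    exact ⟨t, m, h1, h2, h3⟩
  have hzero : IsBounded w fun _ => 0 := fun _ => by simp
  refine Runs.assign_seq hzero ?_
  simp only [Expr.eval, varCount, hw.size_eq]
  -- The zero memory already encodes no ones, no steps and no tested variables; only the upper end
  -- in register 2 has to be set.
  have hinit : LoopInvariant w x (T.eval x) n (T.tests x)
      (Function.update (fun _ => 0) 2 n) := by
    refine ⟨fun _ => none, le_rfl, ⟨hzero.update 2 (size_le_cellBound (by omega)), ?_, ?_, ?_,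
      fun j hj => ?_⟩, rfl, rfl⟩
    · simp [count]
    · simp [count]
    · simp
    · rw [Function.update_of_ne (by omega)]
      simp [testedFlag]
  have hloop : Runs w x (.loop (.sub varCount (reg 9)) stepProgram)
      (Function.update (fun _ => 0) 2 n) (T.tests x)
      fun m' => Runs w x (.assign (.lit 0) (valueAt (reg 1))) m' []
        fun m => m 0 = (T.eval x).toNat := by
    refine Runs.loop (I := LoopInvariant w x (T.eval x)) (fun k L m h => ?_) (fun k L m h => ?_)
      (fun L m h => ?_) hn hinit
    · obtain ⟨b, -, hm, -⟩ := h
      exact hm.bounded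
    · refine ⟨?_, runs_stepProgram hw h⟩
      obtain ⟨b, hk, hm, -⟩ := h
      simp only [Expr.eval, varCount, reg, hw.size_eq, hm.counter]
      omega
    · obtain ⟨b, -, hm, hL, hv⟩ := h
      refine ⟨by simp only [Expr.eval, varCount, reg, hw.size_eq, hm.counter]; omega, hL, ?_⟩
      refine Runs.assign hm.bounded ?_
      simp only [Expr.eval, valueAt, reg, hm.lower, Function.update_self]
      -- After `n` steps no fuel is left, so the rest of the tree is a leaf labelled by the value at
      -- the lower end.
      rw [hv, greedyTree, DecisionTree.eval]
      have := hw.value_le (count true b) (by have := count_add_count_le b; omega)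
      interval_cases w.getD (1 + count true b) 0 <;> rfl
  have := Runs.seq hloop
  rwa [List.append_nil] at this

end GreedyProgram
end SBFE

/-! ### Assembling the theorem -/

open SBFE
theorem theorem2 :
    ∃ K : ℝ,
      -- the construction is a goal function, of goal value at most `n (n + 1) / 2`
      (∀ (n : ℕ) (f : (Fin n → Bool) → Bool), IsSymmetric f →
        IsGoalFunction f (goalFunction (valueVector f)) (goalValue (valueVector f)) ∧
        goalValue (valueVector f) ≤ n * (n + 1) / 2) ∧
      -- Adaptive Greedy on it is an `O(log n)`-approximation, for arbitrary real parameters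
      (∀ (n : ℕ) (f : (Fin n → Bool) → Bool) (c p : Fin n → ℝ), 2 ≤ n → IsSymmetric f →
        (∀ i, 0 < c i) → (∀ i, 0 < p i ∧ p i < 1) →
        ∀ T T' : DecisionTree n,
          IsAdaptiveGreedy (goalFunction (valueVector f)) (goalValue (valueVector f)) c p T →
          T'.Computes f →
          T.expectedCost c p ≤ K * Real.log n * T'.expectedCost c p) ∧
      -- a single program carries it out in polynomial time and outputs the value of `f`
      ∃ (P : Program) (q : Polynomial ℕ),
        ∀ (n : ℕ) (f : (Fin n → Bool) → Bool) (c p : Fin n → ℚ), IsSymmetric f →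
          (∀ i, 0 < c i) → (∀ i, 0 < p i ∧ p i < 1) →
          ∃ T : DecisionTree n,
            Implements P (encodeInstance (valueVector f) c p) T
              (q.eval (inputSize (encodeInstance (valueVector f) c p))) ∧
            T.Computes f ∧
            IsAdaptiveGreedy (goalFunction (valueVector f)) (goalValue (valueVector f))
              (fun i => (c i : ℝ)) (fun i => (p i : ℝ)) T ∧
            (2 ≤ n → ∀ T' : DecisionTree n, T'.Computes f →
              T.expectedCost (fun i => (c i : ℝ)) (fun i => (p i : ℝ)) ≤
                K * Real.log n *
                  T'.expectedCost (fun i => (c i : ℝ)) (fun i => (p i : ℝ))) := by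
  have approx : ∀ (n : ℕ) (f : (Fin n → Bool) → Bool) (c p : Fin n → ℝ), 2 ≤ n → IsSymmetric f →
      (∀ i, 0 < c i) → (∀ i, 0 < p i ∧ p i < 1) → ∀ T T' : DecisionTree n,
        IsAdaptiveGreedy (goalFunction (valueVector f)) (goalValue (valueVector f)) c p T →
        T'.Computes f → T.expectedCost c p ≤ 4 * Real.log n * T'.expectedCost c p := by
    intro n f c p hn hf hc hp T T' hT hT'
    refine (hT.expectedCost_le (goalFunction_isGoalFunction hf) hc hp hT').trans ?_
    refine mul_le_mul_of_nonneg_right (harmonic_le_mul_log hn goalValue_le) ?_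
    rw [expectedCost_eq_costGiven]
    exact (residualCost_nonneg hc hp T' _).trans (residualCost_le_costGiven hc hp T' _)
  refine ⟨4, fun n f hf => ⟨goalFunction_isGoalFunction hf, goalValue_le⟩, approx,
    greedyProgram, greedyProgram.timeBound, fun n f c p hf hc hp => ?_⟩
  have hgreedy : IsAdaptiveGreedy (goalFunction (valueVector f)) (goalValue (valueVector f))
      (fun i => (c i : ℝ)) (fun i => (p i : ℝ))
      (greedyTree (encodeInstance (valueVector f) c p) n fun _ => none) :=
    greedyTree_isAdaptiveGreedyFrom hc hp n (by simp)
  refine ⟨_, implements_greedyProgram (validInput_encodeInstance hc hp),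
    fun x => IsAdaptiveGreedyFrom.eval_greedyTree hf n hgreedy fun i hi => absurd rfl hi,
    hgreedy, fun hn T' hT' => approx n f _ _ hn hf (fun i => by exact_mod_cast hc i)
      (fun i => by exact_mod_cast hp i) _ T' hgreedy hT'⟩
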